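/- **Theorem 4 (Graham–Lee connection).** Let $\Omega\subset\mathbb{C}^n$ be a bounded strictly pseudoconvex domain with smooth boundary: there are an open set $U\supset\overline\Omega$ and a real valued $\varphi\in C^\infty(U)$ with $\Omega=\{z\in U:\varphi(z)<0\}$, $\partial\Omega=\{z\in U:\varphi(z)=0\}$, $d\varphi\neq 0$ on $\partial\Omega$, and the Levi form $L_\theta$ below is positive definite at every point of $\partial\Omega$. Put $\theta=\frac{i}{2}(\bar\partial-\partial)\varphi$, so that $d\theta=i\partial\bar\partial\varphi$, with the convention $2\,d\alpha(X,Y)=X(\alpha(Y))-Y(\alpha(X))-\alpha([X,Y])$; let $J$ be the complex structure of $\mathbb{C}^n$. Where $d\varphi\neq0$, let $T(\mathcal F)=\ker d\varphi$ be the tangent bundle of the foliation $\mathcal F$ by level sets of $\varphi$, let $T_{1,0}(\mathcal F)=T^{1,0}(\mathbb{C}^n)\cap[T(\mathcal F)\otimes\mathbb{C}]$, $T_{0,1}(\mathcal F)=\overline{T_{1,0}(\mathcal F)}$, $H(\mathcal F)=\mathrm{Re}\{T_{1,0}(\mathcal F)\oplus T_{0,1}(\mathcal F)\}$, and let $L_\theta(Z,\overline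 W)=-i\,(d\theta)(Z,\overline W)$ for $Z,W\in T_{1,0}(\mathcal F)$. There is a one-sided neighbourhood of $\partial\Omega$ foliated by strictly pseudoconvex level sets of $\varphi$, that is, an open set $V\subseteq\Omega$ which contains $O\cap\Omega$ for some open $O\supseteq\partial\Omega$, and such that $d\varphi\ne0$ and $L_\theta$ is positive definite at every point of $V$. Let $V$ be any such set. On $V$ let $\xi$ be the unique vector field of type $(1,0)$ with $\partial\varphi(\xi)=1$ and $\partial\bar\partial\varphi(\xi,\overline Z)=0$ for all $Z\in T_{1,0}(\mathcal F)$; let $N$ and $T$ be the real vector fields with $\xi=\frac12(N-iT)$, and $r=2\,\partial\bar\partial\varphi(\xi,\bar\xi)$. Let $g_\theta$ be the metric on $T(\mathcal F)=H(\mathcal F)\oplus\mathbb{R}T$ with $g_\theta(X,Y)=(d\theta)(X,JY)$, $g_\theta(X,T)=0$, $g_\theta(T,T)=1$ for $X,Y\in H(\mathcal F)$; let $\pi_H:T(\mathcal F)\to H(\mathcal F)$ be the projection along $T$, and let $\nabla^Hr=\pi_H\nabla r$, where $\nabla r\in T(\mathcal F)$ is defined by $g_\theta(\nabla r,X)=X(r)$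 for $X\in T(\mathcal F)$. For a linear connection $\nabla$ on $V$ with torsion $T_\nabla$ put $\tau(X)=T_\nabla(T,X)$. (All operators are extended $\mathbb{C}$-linearly.) Then there is a unique linear connection $\nabla$ on $V$ such that i) $T_{1,0}(\mathcal F)$ is parallel with respect to $\nabla$; ii) $\nabla L_\theta=0$, $\nabla T=0$, $\nabla N=0$; iii) $T_\nabla$ is pure, i.e. for all $Z,W\in T_{1,0}(\mathcal F)$ $$T_\nabla(Z,W)=0,\qquad T_\nabla(Z,\overline W)=2i\,L_\theta(Z,\overline W)\,T,\qquad T_\nabla(N,W)=r\,W+i\,\tau(W),$$ $$\tau(T_{1,0}(\mathcal F))\subseteq T_{0,1}(\mathcal F),\qquad \tau(N)=-J\nabla^Hr-2r\,T.$$ -/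

import Mathlib

open scoped ContDiff Manifold

noncomputable section

namespace GrahamLee

/-! ### The complexified tangent space -/

/-- The complexification `E ⊗ ℂ` of a real vector space: `⟨a, b⟩` stands for `a + i b`. -/
@[ext] structure CTangent (E : Type*) where
  /-- the real part -/
  re : E
  /-- the imaginary part -/
  im : E

section Forms

variable {E : Type*} [NormedAddCommGroup E] [NormedSpace ℂ E]

instance : Zero (CTangent E) := ⟨⟨0, 0⟩⟩

instance : Add (CTangent E) := ⟨fun v w => ⟨v.re + w.re, v.im + w.im⟩⟩

/-- `(s + i t) (a + i b) = (s a - t b) + i (s b + t a)`. -/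
instance : SMul ℂ (CTangent E) :=
  ⟨fun c v => ⟨c.re • v.re - c.im • v.im, c.re • v.im + c.im • v.re⟩⟩

/-- A real tangent vector seen in the complexification. -/
def ofReal (v : E) : CTangent E := ⟨v, 0⟩

/-- Complex conjugation `a + i b ↦ a - i b` on `E ⊗ ℂ`. -/
def conj (v : CTangent E) : CTangent E := ⟨v.re, -v.im⟩

/-- The `ℂ`-linear extension to `E ⊗ ℂ` of the complex structure `J v = i v` of `E`. -/
def complexJ (v : CTangent E) : CTangent E := ⟨Complex.I • v.re, Complex.I • v.im⟩

/-- The vectors of type `(1, 0)`: the `i`-eigenspace of `J`. -/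
def IsType10 (v : CTangent E) : Prop := complexJ v = Complex.I • v

/-- `ℂ`-linear extension of a complex valued real-linear form. -/
def extend₁ (α : E → ℂ) (v : CTangent E) : ℂ := α v.re + Complex.I * α v.im

/-- `ℂ`-bilinear extension of a complex valued real-bilinear form. -/
def extend₂ (β : E → E → ℂ) (v w : CTangent E) : ℂ :=
  (β v.re w.re - β v.im w.im) + Complex.I * (β v.re w.im + β v.im w.re)

/-! ### Differential forms attached to `φ`

A complex valued 1-form on `E` is written as a function `α : E → E → ℂ` of a point and a vector. -/

/-- Exterior derivative of a 1-form, with the normalisation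
`2 (dα)(X, Y) = X (α Y) - Y (α X) - α [X, Y]`, evaluated on constant vector fields. -/
def extDer (α : E → E → ℂ) (z v w : E) : ℂ :=
  (1 / 2) * (fderiv ℝ (fun y => α y w) z v - fderiv ℝ (fun y => α y v) z w)

/-- `∂φ = (dφ - i dφ ∘ J) / 2`. -/
def del (φ : E → ℝ) (z v : E) : ℂ :=
  (1 / 2) * ((fderiv ℝ φ z v : ℂ) - Complex.I * (fderiv ℝ φ z (Complex.I • v) : ℂ))

/-- `∂̄φ = (dφ + i dφ ∘ J) / 2`. -/
def delbar (φ : E → ℝ) (z v : E) : ℂ :=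
  (1 / 2) * ((fderiv ℝ φ z v : ℂ) + Complex.I * (fderiv ℝ φ z (Complex.I • v) : ℂ))

/-- `∂∂̄φ = d(∂̄φ)` (recall `∂̄∂̄φ = 0`). -/
def deldelbar (φ : E → ℝ) : E → E → E → ℂ := extDer (delbar φ)

/-- `θ = (i/2) (∂̄ - ∂) φ`, as a complex valued form (it is in fact real). -/
def theta (φ : E → ℝ) (z v : E) : ℂ := (Complex.I / 2) * (delbar φ z v - del φ z v)

/-- `dθ`. -/
def dtheta (φ : E → ℝ) : E → E → E → ℂ := extDer (theta φ)

/-! ### The foliation by level sets of `φ` -/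

/-- The tangent space `T(𝓕)_z` of the level set of `φ` through `z`. -/
def leafTangent (φ : E → ℝ) (z : E) : Set E := {v | fderiv ℝ φ z v = 0}

/-- `T_{1,0}(𝓕)_z = T^{1,0} ∩ (T(𝓕)_z ⊗ ℂ)`. -/
def T10 (φ : E → ℝ) (z : E) : Set (CTangent E) :=
  {v | IsType10 v ∧ v.re ∈ leafTangent φ z ∧ v.im ∈ leafTangent φ z}

/-- `T_{0,1}(𝓕)_z`, the complex conjugate of `T_{1,0}(𝓕)_z`. -/
def T01 (φ : E → ℝ) (z : E) : Set (CTangent E) := {v | conj v ∈ T10 φ z}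

/-- The Levi form `L_θ(Z, W̄) = -i (dθ)(Z, W̄)`; the second argument is the vector `W̄` itself. -/
def levi (φ : E → ℝ) (z : E) (v w : CTangent E) : ℂ :=
  -Complex.I * extend₂ (dtheta φ z) v w

/-- The level set of `φ` through `z` is regular at `z` and its Levi form `L_θ` is positive
definite there. -/
def IsStrictlyPseudoconvexAt (φ : E → ℝ) (z : E) : Prop :=
  fderiv ℝ φ z ≠ 0 ∧ ∀ v ∈ T10 φ z, v ≠ 0 → 0 < (levi φ z v (conj v)).re

/-- `Ω = {φ < 0}` is a bounded strictly pseudoconvex domain with smooth boundary `{φ = 0}`,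
where `φ` is smooth on the neighbourhood `U` of the closure of `Ω`. -/
structure IsStrictlyPseudoconvexDomain (Ω U : Set E) (φ : E → ℝ) : Prop where
  connected : IsConnected Ω
  bounded : Bornology.IsBounded Ω
  isOpen_U : IsOpen U
  closure_subset : closure Ω ⊆ U
  smooth : ContDiffOn ℝ ∞ φ U
  eq_neg : Ω = {z ∈ U | φ z < 0}
  frontier_eq : frontier Ω = {z ∈ U | φ z = 0}
  strict : ∀ z ∈ frontier Ω, IsStrictlyPseudoconvexAt φ z

/-- `V` is a one-sided neighbourhood of `∂Ω` (an open subset of `Ω` containing all points of `Ω`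
near `∂Ω`) which is foliated by strictly pseudoconvex level sets of `φ`. -/
structure IsFoliatedOneSidedNhd (Ω : Set E) (φ : E → ℝ) (V : Set E) : Prop where
  isOpen : IsOpen V
  subset : V ⊆ Ω
  nhd : ∃ O : Set E, IsOpen O ∧ frontier Ω ⊆ O ∧ O ∩ Ω ⊆ V
  foliated : ∀ z ∈ V, IsStrictlyPseudoconvexAt φ z

/-! ### The fields `ξ`, `T`, `N` and the transverse curvature -/

/-- `v` is of type `(1, 0)`, `∂φ(v) = 1`, and `v` is orthogonal to `T_{1,0}(𝓕)_z` with respect to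
`∂∂̄φ`. -/
def IsXi (φ : E → ℝ) (z : E) (v : CTangent E) : Prop :=
  IsType10 v ∧ extend₁ (del φ z) v = 1 ∧
    ∀ w ∈ T10 φ z, extend₂ (deldelbar φ z) v (conj w) = 0

/-- The complex vector field `ξ`: at every point where the level set of `φ` is strictly
pseudoconvex, the unique vector with the property `IsXi`. -/
def xi (φ : E → ℝ) (z : E) : CTangent E :=
  haveI : Nonempty (CTangent E) := ⟨0⟩
  Classical.epsilon (IsXi φ z)

/-- The real vector field `N`, where `ξ = (N - i T) / 2`. -/
def fieldN (φ : E → ℝ) (z : E) : E := (2 : ℝ) • (xi φ z).re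

/-- The real vector field `T`, where `ξ = (N - i T) / 2`. -/
def fieldT (φ : E → ℝ) (z : E) : E := -((2 : ℝ) • (xi φ z).im)

/-- The transverse curvature `r = 2 ∂∂̄φ(ξ, ξ̄)` (a real number). -/
def transverseCurvature (φ : E → ℝ) (z : E) : ℝ :=
  (2 * extend₂ (deldelbar φ z) (xi φ z) (conj (xi φ z))).re

/-- The projection `π_H : T(𝓕) → H(𝓕)` along `T`. -/
def projH (φ : E → ℝ) (z v : E) : E := v - (theta φ z v).re • fieldT φ z

/-- The metric `g_θ` of `T(𝓕) = H(𝓕) ⊕ ℝ T`: `g_θ(X, Y) = (dθ)(X, J Y)` on `H(𝓕)`, and `T` is a unit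
vector orthogonal to `H(𝓕)`. -/
def gTheta (φ : E → ℝ) (z v w : E) : ℝ :=
  (dtheta φ z (projH φ z v) (Complex.I • projH φ z w)).re
    + (theta φ z v).re * (theta φ z w).re

/-- The tangential gradient `∇r`: the vector of `T(𝓕)_z` with `g_θ(∇r, X) = X(r)` for all
`X ∈ T(𝓕)_z`. -/
def tangentialGradR (φ : E → ℝ) (z : E) : E :=
  Classical.epsilon fun v : E => v ∈ leafTangent φ z ∧
    ∀ w ∈ leafTangent φ z, gTheta φ z v w = fderiv ℝ (transverseCurvature φ) z w

/-- `∇^H r = π_H ∇r`. -/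
def gradHR (φ : E → ℝ) (z : E) : E := projH φ z (tangentialGradR φ z)

end Forms

/-! ### Linear connections -/

section Connections

variable {E : Type*} [NormedAddCommGroup E] [NormedSpace ℂ E]

/-- The underlying operator of a linear connection: `(∇_X Y)(z) = nabla Y z (X z)`. -/
abbrev ConnectionOperator (E : Type*) [NormedAddCommGroup E] [NormedSpace ℂ E] : Type _ :=
  (E → E) → E → E →L[ℝ] E

/-- `nabla` is a (smooth) linear connection on the open set `V`. -/
structure IsLinearConnectionOn (nabla : ConnectionOperator E) (V : Set E) : Prop where
  isCovariantDerivativeOn :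
    IsCovariantDerivativeOn (I := 𝓘(ℝ, E)) (V := fun z : E => TangentSpace 𝓘(ℝ, E) z) E nabla V
  smooth : ∀ X Y : E → E, ContDiffOn ℝ ∞ X V → ContDiffOn ℝ ∞ Y V →
    ContDiffOn ℝ ∞ (fun z => nabla Y z (X z)) V

/-- Two linear connections on `V` coincide: they agree on every field, at every point of `V` where
this field is differentiable (in particular on the smooth fields on `V`). -/
def AgreeOn (nabla nabla' : ConnectionOperator E) (V : Set E) : Prop :=
  ∀ z ∈ V, ∀ X : E → E, DifferentiableAt ℝ X z → nabla X z = nabla' X z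

/-- The torsion `T_∇(X, Y) = ∇_X Y - ∇_Y X - [X, Y]`. -/
def torsion (nabla : ConnectionOperator E) (X Y : E → E) (z : E) : E :=
  nabla Y z (X z) - nabla X z (Y z) - VectorField.lieBracket ℝ X Y z

/-- The `ℂ`-bilinear extension of the torsion to complex vector fields. -/
def torsionC (nabla : ConnectionOperator E) (Z W : E → CTangent E) (z : E) : CTangent E :=
  ⟨torsion nabla (fun y => (Z y).re) (fun y => (W y).re) z
      - torsion nabla (fun y => (Z y).im) (fun y => (W y).im) z,
    torsion nabla (fun y => (Z y).re) (fun y => (W y).im) z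
      + torsion nabla (fun y => (Z y).im) (fun y => (W y).re) z⟩

/-- The derivative `∇_v Z = ∇_v (Re Z) + i ∇_v (Im Z)` of a complex vector field in the direction
of a real tangent vector `v`. -/
def covC (nabla : ConnectionOperator E) (Z : E → CTangent E) (z v : E) : CTangent E :=
  ⟨nabla (fun y => (Z y).re) z v, nabla (fun y => (Z y).im) z v⟩

/-- `Z` is a smooth section of `T_{1,0}(𝓕)` over `V`. -/
def IsSectionT10 (φ : E → ℝ) (V : Set E) (Z : E → CTangent E) : Prop :=
  ContDiffOn ℝ ∞ (fun y => (Z y).re) V ∧ ContDiffOn ℝ ∞ (fun y => (Z y).im) V ∧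
    ∀ z ∈ V, Z z ∈ T10 φ z

/-- `τ(X) = T_∇(T, X)`, extended `ℂ`-linearly to complex vector fields. -/
def tau (φ : E → ℝ) (nabla : ConnectionOperator E) (Z : E → CTangent E) (z : E) : CTangent E :=
  torsionC nabla (fun y => ofReal (fieldT φ y)) Z z

/-- The torsion of `nabla` is pure. -/
structure IsPure (φ : E → ℝ) (V : Set E) (nabla : ConnectionOperator E) : Prop where
  torsion_Z_W : ∀ Z W, IsSectionT10 φ V Z → IsSectionT10 φ V W → ∀ z ∈ V,
    torsionC nabla Z W z = 0
  torsion_Z_Wbar : ∀ Z W, IsSectionT10 φ V Z → IsSectionT10 φ V W → ∀ z ∈ V,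
    torsionC nabla Z (fun y => conj (W y)) z
      = (2 * Complex.I * levi φ z (Z z) (conj (W z))) • ofReal (fieldT φ z)
  torsion_N_W : ∀ W, IsSectionT10 φ V W → ∀ z ∈ V,
    torsionC nabla (fun y => ofReal (fieldN φ y)) W z
      = (transverseCurvature φ z : ℂ) • W z + Complex.I • tau φ nabla W z
  tau_T10 : ∀ W, IsSectionT10 φ V W → ∀ z ∈ V, tau φ nabla W z ∈ T01 φ z
  tau_N : ∀ z ∈ V, torsion nabla (fieldT φ) (fieldN φ) z
      = -(Complex.I • gradHR φ z) - (2 * transverseCurvature φ z) • fieldT φ z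

/-- The axioms of the Graham-Lee connection: `nabla` is a linear connection on `V`, `T_{1,0}(𝓕)` is
parallel, `∇L_θ = 0`, `∇T = 0`, `∇N = 0`, and the torsion is pure. -/
structure IsGrahamLeeConnection (φ : E → ℝ) (V : Set E) (nabla : ConnectionOperator E) :
    Prop where
  isLinearConnectionOn : IsLinearConnectionOn nabla V
  parallel_T10 : ∀ Z, IsSectionT10 φ V Z → ∀ z ∈ V, ∀ v : E, covC nabla Z z v ∈ T10 φ z
  parallel_levi : ∀ Z W, IsSectionT10 φ V Z → IsSectionT10 φ V W → ∀ z ∈ V, ∀ v : E,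
    fderiv ℝ (fun y => levi φ y (Z y) (conj (W y))) z v
      = levi φ z (covC nabla Z z v) (conj (W z))
        + levi φ z (Z z) (covC nabla (fun y => conj (W y)) z v)
  parallel_T : ∀ z ∈ V, nabla (fieldT φ) z = 0
  parallel_N : ∀ z ∈ V, nabla (fieldN φ) z = 0
  isPure : IsPure φ V nabla

end Connections

end GrahamLee

end

/-!
The complexified objects reduce to real ones: a vector of `T_{1,0}(𝓕)` is `a - i J a` with `a` in the
complex tangent space `H(𝓕)`, and `dθ(v, J w) = G(v, w)` where `G` is a quarter of
`Hess φ(v, w) + Hess φ(J v, J w)`. Strict pseudoconvexity says that `G` is positive definite on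
`H(𝓕)`, which is an open condition (`eventually_isStrictlyPseudoconvexAt`); this gives the one-sided
neighbourhood. The field `N`, with `T = J N` and `r = G(N, N)`, solves a nonsingular linear system
with smooth coefficients (`bordered`), so it is smooth, and `E = H(𝓕) ⊕ ℝ N ⊕ ℝ T`.

Existence. Since `E` is flat with parallel `J`, a connection is `∇ = D + A` for a connection form `A`.
Write `K(u, v, w) = (D_u G)(v, w) + (D_{J u} G)(v, J w)`. On `H(𝓕)` the conditions of metricity and
purity lead to `∇_v Y = π_H D_v Y + C(v) Y - r θ(v) J Y` with `G(C(v) Y, W) = K(v, Y, W) / 2`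
(`chern`, `connForm`), for `v` in all directions including `N` and `T`. This connection is visibly
`J`-linear, and it is metric because `K(v, Y, W) + K(v, W, Y) = 2 (D_v G)(Y, W)`. Purity comes from
the symmetry of the third derivative of `φ`: `K` is symmetric in its first two arguments, whence
`T_∇(a, b) = 2 dθ(a, b) T` on `H(𝓕)`; differentiating `G(N, ·) = (r / 2) dφ` shows that the
endomorphism `τ` of `H(𝓕)` is `J`-antilinear (`torsionEndo_J`) and yields the bracket
`[N, T] = -J ∇ᴴ r - 2 r T` (`connForm_torsion_T_N`).

Uniqueness. Two linear connections differ by a tensor `D`. If both satisfy the axioms, then `D`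
annihilates `N` and `T`, is complex linear on `H(𝓕)`, and there it is skew for `G` in its values and
symmetric in its arguments, hence zero. The type condition on `τ` and the formula for `T_∇(N, W)` then
remove the components in the directions `T` and `N` (`IsFoliatedOn.difference_eq_zero`).
-/

noncomputable section

namespace GrahamLee

section

/-! ### The complex structure and the Levi metric -/

variable {E : Type*} [NormedAddCommGroup E] [NormedSpace ℂ E]

/-- The complex structure `v ↦ i v` of `E`, as a real continuous linear map. -/
def J : E →L[ℝ] E := (Complex.I • ContinuousLinearMap.id ℂ E).restrictScalars ℝ

theorem J_apply (v : E) : J v = Complex.I • v := rfl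

@[simp] theorem J_J (v : E) : J (J v) = -v := by
  simp [J_apply, smul_smul]

/-- The real Hessian of `φ`. -/
def hess (φ : E → ℝ) (z : E) : E →L[ℝ] E →L[ℝ] ℝ := fderiv ℝ (fderiv ℝ φ) z

/-- Precomposition of real linear forms with `J`. -/
def precompJ : (E →L[ℝ] ℝ) →L[ℝ] (E →L[ℝ] ℝ) := (ContinuousLinearMap.compL ℝ E E ℝ).flip J

@[simp] theorem precompJ_apply (l : E →L[ℝ] ℝ) (v : E) : precompJ l v = l (J v) := rfl

/-- The map `β ↦ (β(v, w) + β(J v, J w)) / 4`, one half of the projection onto `J`-invariant bilinear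
forms. It is bundled as a continuous linear map so that it can be differentiated through. -/
def invariantPart : (E →L[ℝ] E →L[ℝ] ℝ) →L[ℝ] (E →L[ℝ] E →L[ℝ] ℝ) :=
  (1 / 4 : ℝ) • (ContinuousLinearMap.id ℝ _ +
    (ContinuousLinearMap.compL ℝ E (E →L[ℝ] ℝ) (E →L[ℝ] ℝ) precompJ).comp
      ((ContinuousLinearMap.compL ℝ E E (E →L[ℝ] ℝ)).flip J))

theorem invariantPart_apply (β : E →L[ℝ] E →L[ℝ] ℝ) (v w : E) :
    invariantPart β v w = 1 / 4 * (β v w + β (J v) (J w)) := by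
  simp only [invariantPart]
  simp
  ring

/-- The symmetric form `G(v, w) = dθ(v, J w)`, defined on all of `E`; it is the `J`-invariant part
of the Hessian of `φ`, and is positive definite only on the complex tangent spaces of strictly
pseudoconvex level sets. -/
def leviMetric (φ : E → ℝ) (z : E) : E →L[ℝ] E →L[ℝ] ℝ := invariantPart (hess φ z)

/-- The complex tangent space `H(𝓕)_z` of the level set of `φ` through `z`. -/
def horizontal (φ : E → ℝ) (z : E) : Submodule ℝ E where
  carrier := {v | fderiv ℝ φ z v = 0 ∧ fderiv ℝ φ z (J v) = 0}
  add_mem' := by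
    rintro a b ⟨h1, h2⟩ ⟨h3, h4⟩
    simp [h1, h2, h3, h4]
  zero_mem' := by simp
  smul_mem' := by
    rintro c a ⟨h1, h2⟩
    simp [h1, h2]

theorem mem_horizontal {φ : E → ℝ} {z v : E} :
    v ∈ horizontal φ z ↔ fderiv ℝ φ z v = 0 ∧ fderiv ℝ φ z (J v) = 0 := Iff.rfl

theorem J_mem_horizontal {φ : E → ℝ} {z v : E} (h : v ∈ horizontal φ z) :
    J v ∈ horizontal φ z := by
  rw [mem_horizontal] at h ⊢
  simp [h.1, h.2]

theorem leviMetric_apply (φ : E → ℝ) (z v w : E) :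
    leviMetric φ z v w = 1 / 4 * (hess φ z v w + hess φ z (J v) (J w)) :=
  invariantPart_apply _ _ _

theorem leviMetric_J_left (φ : E → ℝ) (z v w : E) :
    leviMetric φ z (J v) w = -leviMetric φ z v (J w) := by
  simp [leviMetric_apply]
  ring

section Smooth

variable {φ : E → ℝ} {z : E}

theorem _root_.ContDiffAt.fderiv_infty {F G : Type*} [NormedAddCommGroup F] [NormedSpace ℝ F]
    [NormedAddCommGroup G] [NormedSpace ℝ G] {f : F → G} {x : F} (h : ContDiffAt ℝ ∞ f x) :
    ContDiffAt ℝ ∞ (fderiv ℝ f) x := h.fderiv_right (by simp)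

theorem contDiffAt_hess (h : ContDiffAt ℝ ∞ φ z) : ContDiffAt ℝ ∞ (hess φ) z :=
  h.fderiv_infty.fderiv_infty

theorem contDiffAt_leviMetric (h : ContDiffAt ℝ ∞ φ z) : ContDiffAt ℝ ∞ (leviMetric φ) z := by
  have := ContDiffAt.continuousLinearMap_comp (𝕜 := ℝ) (F := E →L[ℝ] E →L[ℝ] ℝ)
    (G := E →L[ℝ] E →L[ℝ] ℝ) invariantPart (contDiffAt_hess h)
  exact this

theorem _root_.ContDiffAt.differentiableAt_infty {F G : Type*} [NormedAddCommGroup F]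
    [NormedSpace ℝ F] [NormedAddCommGroup G] [NormedSpace ℝ G] {f : F → G} {x : F}
    (h : ContDiffAt ℝ ∞ f x) : DifferentiableAt ℝ f x := h.differentiableAt (by simp)

theorem hess_symm (h : ContDiffAt ℝ ∞ φ z) (v w : E) : hess φ z v w = hess φ z w v :=
  h.isSymmSndFDerivAt (by simp [ENat.LEInfty.out]) v w

theorem fderiv_hess_symm_left (h : ContDiffAt ℝ ∞ φ z) (u v w : E) :
    fderiv ℝ (hess φ) z u v w = fderiv ℝ (hess φ) z v u w := by
  have := h.fderiv_infty.isSymmSndFDerivAt (by simp [ENat.LEInfty.out]) u v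
  exact DFunLike.congr_fun this w

theorem hasFDerivAt_apply_apply {β : E → E →L[ℝ] E →L[ℝ] ℝ} (h : DifferentiableAt ℝ β z)
    (v w : E) : HasFDerivAt (fun y => β y v w) (((fderiv ℝ β z).flip v).flip w) z := by
  have := (h.hasFDerivAt.clm_apply (hasFDerivAt_const v z)).clm_apply (hasFDerivAt_const w z)
  refine this.congr_fderiv ?_
  ext u
  simp

theorem fderiv_hess_apply (h : ContDiffAt ℝ ∞ φ z) (u v w : E) :
    fderiv ℝ (hess φ) z u v w = fderiv ℝ (fun y => hess φ y v w) z u := by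
  rw [(hasFDerivAt_apply_apply (contDiffAt_hess h).differentiableAt_infty v w).fderiv]
  rfl

theorem fderiv_hess_symm_right (h : ∀ᶠ y in nhds z, ContDiffAt ℝ ∞ φ y) (u v w : E) :
    fderiv ℝ (hess φ) z u v w = fderiv ℝ (hess φ) z u w v := by
  rw [fderiv_hess_apply h.self_of_nhds, fderiv_hess_apply h.self_of_nhds]
  congr 1
  apply Filter.EventuallyEq.fderiv_eq
  filter_upwards [h] with y hy using hess_symm hy v w

theorem fderiv_leviMetric (h : ContDiffAt ℝ ∞ φ z) (u v w : E) :
    fderiv ℝ (leviMetric φ) z u v w =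
      1 / 4 * (fderiv ℝ (hess φ) z u v w + fderiv ℝ (hess φ) z u (J v) (J w)) := by
  have h1 := hasFDerivAt_apply_apply (contDiffAt_leviMetric h).differentiableAt_infty v w
  have h2 := hasFDerivAt_apply_apply (contDiffAt_hess h).differentiableAt_infty v w
  have h3 := hasFDerivAt_apply_apply (contDiffAt_hess h).differentiableAt_infty (J v) (J w)
  have h4 := (h2.add h3).const_mul (1 / 4 : ℝ)
  have h5 := (h1.congr_of_eventuallyEq
    (.of_forall fun y => (leviMetric_apply φ y v w).symm)).unique h4
  exact DFunLike.congr_fun h5 u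

theorem leviMetric_symm (h : ContDiffAt ℝ ∞ φ z) (v w : E) :
    leviMetric φ z v w = leviMetric φ z w v := by
  rw [leviMetric_apply, leviMetric_apply, hess_symm h v, hess_symm h (J v)]

theorem leviMetric_self_J (h : ContDiffAt ℝ ∞ φ z) (v : E) : leviMetric φ z v (J v) = 0 := by
  have h1 := leviMetric_J_left φ z v v
  have h2 := leviMetric_symm h (J v) v
  linarith

/-! ### The forms `θ`, `dθ`, `∂∂̄φ` in real terms -/

theorem theta_eq (φ : E → ℝ) (z v : E) :
    theta φ z v = ((-(1 / 2) * fderiv ℝ φ z (J v) : ℝ) : ℂ) := by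
  simp only [theta, delbar, del, J_apply]
  push_cast
  linear_combination (1 / 2) * (fderiv ℝ φ z (Complex.I • v) : ℂ) * Complex.I_sq

theorem theta_re (φ : E → ℝ) (z v : E) : (theta φ z v).re = -(1 / 2) * fderiv ℝ φ z (J v) := by
  rw [theta_eq, Complex.ofReal_re]

theorem hasFDerivAt_fderiv_apply (h : ContDiffAt ℝ ∞ φ z) (w : E) :
    HasFDerivAt (fun y => ((fderiv ℝ φ y w : ℝ) : ℂ))
      (Complex.ofRealCLM.comp ((hess φ z).flip w)) z := by
  have h1 := h.fderiv_infty.differentiableAt_infty.hasFDerivAt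
  have h2 := h1.clm_apply (hasFDerivAt_const w z)
  have h3 := Complex.ofRealCLM.hasFDerivAt.comp z h2
  refine h3.congr_fderiv ?_
  ext v
  simp [hess]

theorem fderiv_theta (h : ContDiffAt ℝ ∞ φ z) (v w : E) :
    fderiv ℝ (fun y => theta φ y w) z v = ((-(1 / 2) * hess φ z v (J w) : ℝ) : ℂ) := by
  have : (fun y => theta φ y w) = fun y => (-(1 / 2) : ℂ) * ((fderiv ℝ φ y (J w) : ℝ) : ℂ) := by
    ext y; rw [theta_eq]; push_cast; ring
  rw [this, ((hasFDerivAt_fderiv_apply h (J w)).const_mul _).fderiv]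
  simp

theorem dtheta_eq (h : ContDiffAt ℝ ∞ φ z) (v w : E) :
    dtheta φ z v w = (leviMetric φ z (J v) w : ℝ) := by
  rw [dtheta, extDer, fderiv_theta h, fderiv_theta h, leviMetric_apply, hess_symm h w]
  simp
  ring

theorem fderiv_delbar (h : ContDiffAt ℝ ∞ φ z) (v w : E) :
    fderiv ℝ (fun y => delbar φ y w) z v =
      (1 / 2) * ((hess φ z v w : ℝ) + Complex.I * (hess φ z v (J w) : ℝ)) := by
  have := (((hasFDerivAt_fderiv_apply h w).add
    ((hasFDerivAt_fderiv_apply h (J w)).const_mul Complex.I)).const_mul (1 / 2 : ℂ)).fderiv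
  change fderiv ℝ (fun y => delbar φ y w) z = _ at this
  rw [this]
  simp
  ring

theorem deldelbar_eq (h : ContDiffAt ℝ ∞ φ z) (v w : E) :
    deldelbar φ z v w = -Complex.I * (leviMetric φ z (J v) w : ℝ) := by
  rw [deldelbar, extDer, fderiv_delbar h, fderiv_delbar h, leviMetric_apply, hess_symm h w v,
    hess_symm h w (J v)]
  simp
  ring

/-! ### Vectors of type `(1, 0)` -/

/-- The vector `a - i J a` of type `(1, 0)` with real part `a`. -/
def typeTen (a : E) : CTangent E := ⟨a, -J a⟩

theorem isType10_iff {v : CTangent E} : IsType10 v ↔ v = typeTen v.re := by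
  constructor
  · intro h
    have h1 := congrArg CTangent.re h
    change Complex.I • v.re = Complex.I.re • v.re - Complex.I.im • v.im at h1
    ext1
    · rfl
    · change v.im = - (Complex.I • v.re)
      rw [h1]; simp
  · intro h
    rw [h]
    ext1
    · change Complex.I • v.re = Complex.I.re • v.re - Complex.I.im • -J v.re
      simp [J_apply]
    · change Complex.I • (-J v.re) = Complex.I.re • (-J v.re) + Complex.I.im • v.re
      rw [← J_apply]; simp

theorem isType10_typeTen (a : E) : IsType10 (typeTen a) := isType10_iff.2 rfl

theorem mem_T10_iff {v : CTangent E} :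
    v ∈ T10 φ z ↔ v = typeTen v.re ∧ v.re ∈ horizontal φ z := by
  change (IsType10 v ∧ fderiv ℝ φ z v.re = 0 ∧ fderiv ℝ φ z v.im = 0) ↔ _
  rw [isType10_iff, mem_horizontal]
  refine and_congr_right fun h => and_congr_right fun _ => ?_
  have : v.im = - J v.re := congrArg CTangent.im h
  rw [this]; simp

theorem typeTen_mem_T10 {a : E} : typeTen a ∈ T10 φ z ↔ a ∈ horizontal φ z := by
  rw [mem_T10_iff]
  exact ⟨fun h => h.2, fun h => ⟨rfl, h⟩⟩

theorem conj_typeTen (a : E) : conj (typeTen a) = ⟨a, J a⟩ := by simp [conj, typeTen]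

/-- The Hermitian form `L_θ` on `T_{1,0}(𝓕)`, through the identification `a ↦ a - i J a` with `H(𝓕)`:
its real part is `2 G` and its imaginary part is `-2 dθ`. -/
theorem levi_typeTen (h : ContDiffAt ℝ ∞ φ z) (a b : E) :
    levi φ z (typeTen a) (conj (typeTen b)) =
      ((2 * leviMetric φ z a b : ℝ) : ℂ) - Complex.I * ((2 * leviMetric φ z (J a) b : ℝ) : ℂ) := by
  rw [conj_typeTen, levi, extend₂]
  simp only [typeTen, dtheta_eq h]
  simp only [map_neg, J_J, neg_neg, leviMetric_J_left φ z _ (J b)]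
  simp only [leviMetric_J_left φ z a]
  push_cast
  linear_combination (-2 * (leviMetric φ z a b : ℂ)) * Complex.I_sq

/-- In real terms, strict pseudoconvexity is positivity of `G` on `H(𝓕)_z`. -/
theorem isStrictlyPseudoconvexAt_iff (h : ContDiffAt ℝ ∞ φ z) :
    IsStrictlyPseudoconvexAt φ z ↔
      fderiv ℝ φ z ≠ 0 ∧ ∀ a ∈ horizontal φ z, a ≠ 0 → 0 < leviMetric φ z a a := by
  refine and_congr_right fun _ => ⟨fun H a ha h0 => ?_, fun H v hv h0 => ?_⟩
  · have h1 := H (typeTen a) (typeTen_mem_T10.2 ha) (fun h2 => h0 (congrArg CTangent.re h2))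
    rw [levi_typeTen h] at h1
    simpa using h1
  · obtain ⟨h1, h2⟩ := mem_T10_iff.1 hv
    rw [h1, levi_typeTen h]
    have := H v.re h2 (fun h3 => h0 (by rw [h1, h3]; ext1 <;> simp [typeTen] <;> rfl))
    simpa using this

end Smooth

end

section

variable {E : Type*} [NormedAddCommGroup E] [NormedSpace ℂ E]

/-! ### The bordered Levi form -/

/-- `φ` is smooth near each point of the open set `V`, and its level sets are regular and strictly
pseudoconvex there. -/
structure IsFoliatedOn (φ : E → ℝ) (V : Set E) : Prop where
  isOpen : IsOpen V
  smooth : ∀ z ∈ V, ContDiffAt ℝ ∞ φ z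
  strict : ∀ z ∈ V, IsStrictlyPseudoconvexAt φ z

/-- The bordered form `(v, s, t) ↦ (G(v, ·) + s dφ + t dφ ∘ J, dφ(v), dφ(J v))`. Inverting it solves
the equations `G(v, ·) = l` on `H(𝓕)_z`, `dφ(v) = a`, `dφ(J v) = b` without choosing a frame of
`H(𝓕)_z`, and the solution depends smoothly on `z`. -/
def bordered (φ : E → ℝ) (z : E) : (E × ℝ × ℝ) →L[ℝ] ((E →L[ℝ] ℝ) × ℝ × ℝ) :=
  (ContinuousLinearMap.inl ℝ (E →L[ℝ] ℝ) (ℝ × ℝ)).comp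
      ((leviMetric φ z).comp (ContinuousLinearMap.fst ℝ E (ℝ × ℝ)) +
        ((ContinuousLinearMap.fst ℝ ℝ ℝ).comp (ContinuousLinearMap.snd ℝ E (ℝ × ℝ))).smulRight
          (fderiv ℝ φ z) +
        ((ContinuousLinearMap.snd ℝ ℝ ℝ).comp (ContinuousLinearMap.snd ℝ E (ℝ × ℝ))).smulRight
          (precompJ (fderiv ℝ φ z))) +
    (ContinuousLinearMap.inr ℝ (E →L[ℝ] ℝ) (ℝ × ℝ)).comp
      ((ContinuousLinearMap.inl ℝ ℝ ℝ).comp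
          ((fderiv ℝ φ z).comp (ContinuousLinearMap.fst ℝ E (ℝ × ℝ))) +
        (ContinuousLinearMap.inr ℝ ℝ ℝ).comp
          ((precompJ (fderiv ℝ φ z)).comp (ContinuousLinearMap.fst ℝ E (ℝ × ℝ))))

theorem bordered_apply (φ : E → ℝ) (z v : E) (s t : ℝ) :
    bordered φ z (v, s, t) =
      (leviMetric φ z v + s • fderiv ℝ φ z + t • precompJ (fderiv ℝ φ z),
        fderiv ℝ φ z v, fderiv ℝ φ z (J v)) := by
  simp [bordered]

theorem contDiffAt_precompJ_fderiv {φ : E → ℝ} {z : E} (h : ContDiffAt ℝ ∞ φ z) :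
    ContDiffAt ℝ ∞ (fun y => precompJ (fderiv ℝ φ y)) z :=
  h.fderiv_infty.clm_comp (contDiffAt_const (c := (J : E →L[ℝ] E)))

theorem contDiffAt_bordered {φ : E → ℝ} {z : E} (h : ContDiffAt ℝ ∞ φ z) :
    ContDiffAt ℝ ∞ (bordered φ) z := by
  have h1 := contDiffAt_leviMetric h
  have h2 := h.fderiv_infty
  have h3 := contDiffAt_precompJ_fderiv h
  unfold bordered
  refine ContDiffAt.add (contDiffAt_const.clm_comp (ContDiffAt.add (ContDiffAt.add
    (h1.clm_comp contDiffAt_const) ?_) ?_))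
    (contDiffAt_const.clm_comp (ContDiffAt.add (contDiffAt_const.clm_comp
      (h2.clm_comp contDiffAt_const)) (contDiffAt_const.clm_comp (h3.clm_comp contDiffAt_const))))
  · exact contDiffAt_const.smulRight h2
  · exact contDiffAt_const.smulRight h3

section

variable {φ : E → ℝ} {z : E}

theorem sum_smul_fderiv_eq_zero (h : fderiv ℝ φ z ≠ 0) {s t : ℝ}
    (hst : s • fderiv ℝ φ z + t • precompJ (fderiv ℝ φ z) = 0) : s = 0 ∧ t = 0 := by
  obtain ⟨u, hu⟩ : ∃ u, fderiv ℝ φ z u ≠ 0 := by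
    by_contra! H
    exact h (by ext u; simp [H u])
  have h1 := DFunLike.congr_fun hst u
  have h2 := DFunLike.congr_fun hst (J u)
  simp only [add_apply, smul_apply, precompJ_apply, J_J,
    map_neg, smul_eq_mul, zero_apply] at h1 h2
  have h3 : 0 < fderiv ℝ φ z u ^ 2 + fderiv ℝ φ z (J u) ^ 2 := by positivity
  constructor
  · have : s * (fderiv ℝ φ z u ^ 2 + fderiv ℝ φ z (J u) ^ 2) = 0 := by
      linear_combination fderiv ℝ φ z u * h1 + fderiv ℝ φ z (J u) * h2
    exact (mul_eq_zero.1 this).resolve_right h3.ne'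
  · have : t * (fderiv ℝ φ z u ^ 2 + fderiv ℝ φ z (J u) ^ 2) = 0 := by
      linear_combination fderiv ℝ φ z (J u) * h1 - fderiv ℝ φ z u * h2
    exact (mul_eq_zero.1 this).resolve_right h3.ne'

theorem eq_zero_of_leviMetric_self (hφ : ContDiffAt ℝ ∞ φ z) (h : IsStrictlyPseudoconvexAt φ z)
    {v : E} (hv : v ∈ horizontal φ z) (h0 : leviMetric φ z v v = 0) : v = 0 := by
  by_contra hne
  exact (((isStrictlyPseudoconvexAt_iff hφ).1 h).2 v hv hne).ne' h0

theorem eq_of_leviMetric_eq (hφ : ContDiffAt ℝ ∞ φ z) (h : IsStrictlyPseudoconvexAt φ z) {v w : E}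
    (hv : v ∈ horizontal φ z) (hw : w ∈ horizontal φ z)
    (H : ∀ c ∈ horizontal φ z, leviMetric φ z v c = leviMetric φ z w c) : v = w := by
  have hm := sub_mem hv hw
  refine sub_eq_zero.1 (eq_zero_of_leviMetric_self hφ h hm ?_)
  rw [ContinuousLinearMap.map_sub₂, H _ hm, sub_self]

theorem bordered_injective (hφ : ContDiffAt ℝ ∞ φ z) (h : IsStrictlyPseudoconvexAt φ z) :
    Function.Injective (bordered φ z) := by
  rw [injective_iff_map_eq_zero]
  rintro ⟨v, s, t⟩ hv
  rw [bordered_apply, Prod.mk_eq_zero, Prod.mk_eq_zero] at hv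
  obtain ⟨h1, h2, h3⟩ := hv
  have h4 := DFunLike.congr_fun h1 v
  simp only [add_apply, smul_apply, precompJ_apply, h2, h3,
    smul_zero, add_zero, zero_apply] at h4
  have h5 := eq_zero_of_leviMetric_self hφ h ⟨h2, h3⟩ h4
  subst h5
  obtain ⟨rfl, rfl⟩ := sum_smul_fderiv_eq_zero h.1 (by simpa using h1)
  rfl

/-- For a linear form `l`, the vector of `H(𝓕)_z` which represents the restriction of `l` to
`H(𝓕)_z` with respect to `G`. -/
def horizontalDual (φ : E → ℝ) (z : E) : (E →L[ℝ] ℝ) →L[ℝ] E :=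
  (ContinuousLinearMap.fst ℝ E (ℝ × ℝ)).comp
    ((bordered φ z).inverse.comp (ContinuousLinearMap.inl ℝ (E →L[ℝ] ℝ) (ℝ × ℝ)))

/-- The vector `N` with `dφ(N) = 2`, `dφ(J N) = 0` which is `G`-orthogonal to `H(𝓕)_z`. -/
def normalField (φ : E → ℝ) (z : E) : E :=
  ((bordered φ z).inverse (0, 2, 0)).1

/-! ### The splitting `E = H(𝓕) ⊕ ℝ N ⊕ ℝ T` -/

/-- The projection of `E` onto `H(𝓕)_z` along `N` and `T = J N`. -/
def projHoriz (φ : E → ℝ) (z : E) : E →L[ℝ] E :=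
  ContinuousLinearMap.id ℝ E - ((1 / 2 : ℝ) • fderiv ℝ φ z).smulRight (normalField φ z) +
    ((1 / 2 : ℝ) • precompJ (fderiv ℝ φ z)).smulRight (J (normalField φ z))

theorem projHoriz_apply (φ : E → ℝ) (z v : E) :
    projHoriz φ z v = v - (1 / 2 * fderiv ℝ φ z v) • normalField φ z +
      (1 / 2 * fderiv ℝ φ z (J v)) • J (normalField φ z) := rfl

theorem eq_projHoriz_add (φ : E → ℝ) (z v : E) :
    v = projHoriz φ z v + (1 / 2 * fderiv ℝ φ z v) • normalField φ z -
      (1 / 2 * fderiv ℝ φ z (J v)) • J (normalField φ z) := by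
  rw [projHoriz_apply]; abel

theorem projHoriz_J (φ : E → ℝ) (z v : E) : projHoriz φ z (J v) = J (projHoriz φ z v) := by
  simp only [projHoriz_apply, map_add, map_sub, map_smul, J_J, map_neg]
  module

theorem projHoriz_of_mem {v : E} (hv : v ∈ horizontal φ z) : projHoriz φ z v = v := by
  simp [projHoriz_apply, hv.1, hv.2]

/-- The transverse curvature, as the squared `G`-length of `N`. -/
def curvature (φ : E → ℝ) (z : E) : ℝ := leviMetric φ z (normalField φ z) (normalField φ z)

theorem extend_del_typeTen (φ : E → ℝ) (z a : E) :
    extend₁ (del φ z) (typeTen a) =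
      (fderiv ℝ φ z a : ℂ) - Complex.I * (fderiv ℝ φ z (J a) : ℂ) := by
  simp only [extend₁, typeTen, del, ← J_apply, map_neg, J_J, neg_neg]
  push_cast
  linear_combination (-(1 / 2) * (fderiv ℝ φ z a : ℂ)) * Complex.I_sq

theorem extend_deldelbar_typeTen (hφ : ContDiffAt ℝ ∞ φ z) (a b : E) :
    extend₂ (deldelbar φ z) (typeTen a) (conj (typeTen b)) =
      ((2 * leviMetric φ z a b : ℝ) : ℂ) - Complex.I * ((2 * leviMetric φ z (J a) b : ℝ) : ℂ) := by
  rw [← levi_typeTen hφ, levi]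
  simp only [extend₂, dtheta_eq hφ, deldelbar_eq hφ]
  ring

variable [FiniteDimensional ℂ E]

theorem bordered_isInvertible (hφ : ContDiffAt ℝ ∞ φ z) (h : IsStrictlyPseudoconvexAt φ z) :
    (bordered φ z).IsInvertible := by
  have hdim : Module.finrank ℝ (E × ℝ × ℝ) = Module.finrank ℝ ((E →L[ℝ] ℝ) × ℝ × ℝ) := by
    have : Module.finrank ℝ (E →L[ℝ] ℝ) = Module.finrank ℝ E :=
      ((LinearMap.toContinuousLinearMap (𝕜 := ℝ) (E := E) (F' := ℝ)).finrank_eq).symm.trans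
        Subspace.dual_finrank_eq
    simp [this]
  exact ⟨(LinearMap.linearEquivOfInjective (bordered φ z : _ →ₗ[ℝ] _)
    (bordered_injective hφ h) hdim).toContinuousLinearEquiv, by ext <;> rfl⟩

theorem contDiffAt_inverse_bordered (hφ : ContDiffAt ℝ ∞ φ z)
    (h : IsStrictlyPseudoconvexAt φ z) :
    ContDiffAt ℝ ∞ (fun y => (bordered φ y).inverse) z :=
  have := FiniteDimensional.complete ℝ E
  ((bordered_isInvertible hφ h).contDiffAt_map_inverse).comp z (contDiffAt_bordered hφ)

theorem contDiffAt_normalField (hφ : ContDiffAt ℝ ∞ φ z) (h : IsStrictlyPseudoconvexAt φ z) :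
    ContDiffAt ℝ ∞ (normalField φ) z :=
  ((contDiffAt_inverse_bordered hφ h).clm_apply contDiffAt_const).fst

theorem contDiffAt_horizontalDual (hφ : ContDiffAt ℝ ∞ φ z) (h : IsStrictlyPseudoconvexAt φ z) :
    ContDiffAt ℝ ∞ (horizontalDual φ) z :=
  contDiffAt_const.clm_comp ((contDiffAt_inverse_bordered hφ h).clm_comp contDiffAt_const)

theorem inverse_bordered_spec (hφ : ContDiffAt ℝ ∞ φ z) (h : IsStrictlyPseudoconvexAt φ z)
    (l : E →L[ℝ] ℝ) (a b : ℝ) :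
    fderiv ℝ φ z ((bordered φ z).inverse (l, a, b)).1 = a ∧
      fderiv ℝ φ z (J ((bordered φ z).inverse (l, a, b)).1) = b ∧
      ∀ w ∈ horizontal φ z, leviMetric φ z ((bordered φ z).inverse (l, a, b)).1 w = l w := by
  have h1 := (bordered_isInvertible hφ h).self_apply_inverse (l, a, b)
  generalize (bordered φ z).inverse (l, a, b) = x at h1
  obtain ⟨v, s, t⟩ := x
  rw [bordered_apply, Prod.mk.injEq, Prod.mk.injEq] at h1
  refine ⟨h1.2.1, h1.2.2, fun w hw => ?_⟩
  simpa [hw.1, hw.2] using DFunLike.congr_fun h1.1 w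

theorem horizontalDual_mem (hφ : ContDiffAt ℝ ∞ φ z) (h : IsStrictlyPseudoconvexAt φ z)
    (l : E →L[ℝ] ℝ) : horizontalDual φ z l ∈ horizontal φ z :=
  ⟨(inverse_bordered_spec hφ h l 0 0).1, (inverse_bordered_spec hφ h l 0 0).2.1⟩

theorem leviMetric_horizontalDual (hφ : ContDiffAt ℝ ∞ φ z) (h : IsStrictlyPseudoconvexAt φ z)
    (l : E →L[ℝ] ℝ) {w : E} (hw : w ∈ horizontal φ z) :
    leviMetric φ z (horizontalDual φ z l) w = l w :=
  (inverse_bordered_spec hφ h l 0 0).2.2 w hw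

theorem fderiv_normalField (hφ : ContDiffAt ℝ ∞ φ z) (h : IsStrictlyPseudoconvexAt φ z) :
    fderiv ℝ φ z (normalField φ z) = 2 := (inverse_bordered_spec hφ h 0 2 0).1

theorem fderiv_J_normalField (hφ : ContDiffAt ℝ ∞ φ z) (h : IsStrictlyPseudoconvexAt φ z) :
    fderiv ℝ φ z (J (normalField φ z)) = 0 := (inverse_bordered_spec hφ h 0 2 0).2.1

theorem leviMetric_normalField (hφ : ContDiffAt ℝ ∞ φ z) (h : IsStrictlyPseudoconvexAt φ z)
    {w : E} (hw : w ∈ horizontal φ z) : leviMetric φ z (normalField φ z) w = 0 :=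
  (inverse_bordered_spec hφ h 0 2 0).2.2 w hw

theorem contDiffAt_projHoriz (hφ : ContDiffAt ℝ ∞ φ z) (h : IsStrictlyPseudoconvexAt φ z) :
    ContDiffAt ℝ ∞ (projHoriz φ) z := by
  have h1 := hφ.fderiv_infty
  have h2 := contDiffAt_precompJ_fderiv hφ
  have h3 := contDiffAt_normalField hφ h
  have h4 := (contDiffAt_const (c := (J : E →L[ℝ] E))).clm_apply h3
  have h5 := (h1.const_smul (1 / 2 : ℝ)).smulRight h3
  have h6 := (h2.const_smul (1 / 2 : ℝ)).smulRight h4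
  exact (contDiffAt_const.sub h5).add h6

theorem projHoriz_mem (hφ : ContDiffAt ℝ ∞ φ z) (h : IsStrictlyPseudoconvexAt φ z) (v : E) :
    projHoriz φ z v ∈ horizontal φ z := by
  rw [mem_horizontal, projHoriz_apply]
  simp only [map_add, map_sub, map_smul, J_J, map_neg, smul_eq_mul, fderiv_normalField hφ h,
    fderiv_J_normalField hφ h]
  constructor <;> ring

theorem projHoriz_normalField (hφ : ContDiffAt ℝ ∞ φ z) (h : IsStrictlyPseudoconvexAt φ z) :
    projHoriz φ z (normalField φ z) = 0 := by
  simp [projHoriz_apply, fderiv_normalField hφ h, fderiv_J_normalField hφ h]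

theorem projHoriz_J_normalField (hφ : ContDiffAt ℝ ∞ φ z) (h : IsStrictlyPseudoconvexAt φ z) :
    projHoriz φ z (J (normalField φ z)) = 0 := by
  rw [projHoriz_J, projHoriz_normalField hφ h, map_zero]

theorem leviMetric_normalField_left (hφ : ContDiffAt ℝ ∞ φ z) (h : IsStrictlyPseudoconvexAt φ z)
    (v : E) : leviMetric φ z (normalField φ z) v = 1 / 2 * fderiv ℝ φ z v * curvature φ z := by
  conv_lhs => rw [eq_projHoriz_add φ z v]
  simp [leviMetric_normalField hφ h (projHoriz_mem hφ h v), leviMetric_self_J hφ, curvature]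

theorem leviMetric_projHoriz_left (hφ : ContDiffAt ℝ ∞ φ z) (h : IsStrictlyPseudoconvexAt φ z)
    (v : E) {c : E} (hc : c ∈ horizontal φ z) :
    leviMetric φ z (projHoriz φ z v) c = leviMetric φ z v c := by
  rw [projHoriz_apply]
  simp [leviMetric_normalField hφ h hc, leviMetric_J_left,
    leviMetric_normalField hφ h (J_mem_horizontal hc)]

/-! ### The fields `ξ`, `N`, `T` -/

/-- The conditions on `ξ` mean that `2 Re ξ` solves the linear system defining `normalField`. -/
theorem isXi_iff (hφ : ContDiffAt ℝ ∞ φ z) (h : IsStrictlyPseudoconvexAt φ z) (v : CTangent E) :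
    IsXi φ z v ↔ v = typeTen ((1 / 2 : ℝ) • normalField φ z) := by
  constructor
  · rintro ⟨h1, h2, h3⟩
    rw [isType10_iff] at h1
    rw [h1]
    congr 1
    rw [h1, extend_del_typeTen] at h2
    have hre : fderiv ℝ φ z v.re = 1 := by simpa using congrArg Complex.re h2
    have him : fderiv ℝ φ z (J v.re) = 0 := by simpa using congrArg Complex.im h2
    have h4 : ∀ b ∈ horizontal φ z, leviMetric φ z v.re b = 0 := fun b hb => by
      have := h3 _ (typeTen_mem_T10.2 hb)
      rw [h1, extend_deldelbar_typeTen hφ] at this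
      simpa [typeTen] using congrArg Complex.re this
    have hm : v.re - (1 / 2 : ℝ) • normalField φ z ∈ horizontal φ z := by
      rw [mem_horizontal]
      simp [hre, him, fderiv_normalField hφ h, fderiv_J_normalField hφ h]
    refine sub_eq_zero.1 (eq_zero_of_leviMetric_self hφ h hm ?_)
    rw [ContinuousLinearMap.map_sub₂, h4 _ hm, map_smul, smul_apply, leviMetric_normalField hφ h hm]
    simp
  · rintro rfl
    refine ⟨isType10_typeTen _, ?_, fun w hw => ?_⟩
    · rw [extend_del_typeTen]
      simp [fderiv_normalField hφ h, fderiv_J_normalField hφ h]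
    · obtain ⟨h1, h2⟩ := mem_T10_iff.1 hw
      rw [h1, extend_deldelbar_typeTen hφ]
      simp [leviMetric_normalField hφ h h2, leviMetric_J_left,
        leviMetric_normalField hφ h (J_mem_horizontal h2)]

theorem xi_eq (hφ : ContDiffAt ℝ ∞ φ z) (h : IsStrictlyPseudoconvexAt φ z) :
    xi φ z = typeTen ((1 / 2 : ℝ) • normalField φ z) :=
  (isXi_iff hφ h _).1 (Classical.epsilon_spec (p := IsXi φ z) ⟨_, (isXi_iff hφ h _).2 rfl⟩)

theorem fieldN_eq (hφ : ContDiffAt ℝ ∞ φ z) (h : IsStrictlyPseudoconvexAt φ z) :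
    fieldN φ z = normalField φ z := by
  simp [fieldN, xi_eq hφ h, typeTen, smul_smul]

theorem fieldT_eq (hφ : ContDiffAt ℝ ∞ φ z) (h : IsStrictlyPseudoconvexAt φ z) :
    fieldT φ z = J (normalField φ z) := by
  simp [fieldT, xi_eq hφ h, typeTen, smul_smul]

theorem transverseCurvature_eq (hφ : ContDiffAt ℝ ∞ φ z) (h : IsStrictlyPseudoconvexAt φ z) :
    transverseCurvature φ z = curvature φ z := by
  rw [transverseCurvature, xi_eq hφ h, extend_deldelbar_typeTen hφ]
  simp [curvature]

end

end

section

variable {E : Type*} [NormedAddCommGroup E] [NormedSpace ℂ E]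

variable {φ : E → ℝ} {V : Set E} {z : E}

/-! ### Differentiating the Levi form and `N` -/

/-- The trilinear form `K(u, v, w) = (D_u G)(v, w) + (D_{J u} G)(v, J w)`; up to the factor `1/2`
it is the Chern connection form of `G` with the last index lowered. -/
def lowChern (φ : E → ℝ) (z : E) : E →L[ℝ] E →L[ℝ] E →L[ℝ] ℝ :=
  fderiv ℝ (leviMetric φ) z +
    (ContinuousLinearMap.compL ℝ E (E →L[ℝ] ℝ) (E →L[ℝ] ℝ) precompJ).comp
      ((fderiv ℝ (leviMetric φ) z).comp J)

theorem lowChern_apply (φ : E → ℝ) (z u v w : E) :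
    lowChern φ z u v w =
      fderiv ℝ (leviMetric φ) z u v w + fderiv ℝ (leviMetric φ) z (J u) v (J w) := rfl

namespace IsFoliatedOn

theorem eventually_mem (hV : IsFoliatedOn φ V) (hz : z ∈ V) : ∀ᶠ y in nhds z, y ∈ V :=
  hV.isOpen.mem_nhds hz

theorem eventually_smooth (hV : IsFoliatedOn φ V) (hz : z ∈ V) :
    ∀ᶠ y in nhds z, ContDiffAt ℝ ∞ φ y :=
  (hV.eventually_mem hz).mono hV.smooth

theorem fderiv_leviMetric_symm (hV : IsFoliatedOn φ V) (hz : z ∈ V) (u v w : E) :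
    fderiv ℝ (leviMetric φ) z u v w = fderiv ℝ (leviMetric φ) z u w v := by
  have hs := fderiv_hess_symm_right (hV.eventually_smooth hz)
  rw [fderiv_leviMetric (hV.smooth z hz), fderiv_leviMetric (hV.smooth z hz), hs u v w,
    hs u (J v) (J w)]

theorem fderiv_leviMetric_J (hV : IsFoliatedOn φ V) (hz : z ∈ V) (u v w : E) :
    fderiv ℝ (leviMetric φ) z u (J v) w = -fderiv ℝ (leviMetric φ) z u v (J w) := by
  rw [fderiv_leviMetric (hV.smooth z hz), fderiv_leviMetric (hV.smooth z hz)]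
  simp
  ring

/-- The symmetry of `K` in its first two arguments is the identity `d(dθ) = 0`, that is, the symmetry
of the third derivative of `φ`; it makes the torsion of the Chern connection vanish on `H(𝓕)`. -/
theorem lowChern_symm (hV : IsFoliatedOn φ V) (hz : z ∈ V) (u v w : E) :
    lowChern φ z u v w = lowChern φ z v u w := by
  have hl := fderiv_hess_symm_left (hV.smooth z hz)
  have hs := fderiv_hess_symm_right (hV.eventually_smooth hz)
  simp only [lowChern_apply, fderiv_leviMetric (hV.smooth z hz), J_J, map_neg]
  rw [hl u v w, hl (J u) v (J w), hl u (J v) (J w), hl (J u) (J v) w,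
    hl v (J u) (J w)]
  have := hs (J v) u (J w)
  ring

theorem lowChern_J_mid (hV : IsFoliatedOn φ V) (hz : z ∈ V) (u v w : E) :
    lowChern φ z u (J v) w = -lowChern φ z u v (J w) := by
  simp only [lowChern_apply, hV.fderiv_leviMetric_J hz, J_J, map_neg]
  ring

theorem lowChern_add_swap (hV : IsFoliatedOn φ V) (hz : z ∈ V) (u v w : E) :
    lowChern φ z u v w + lowChern φ z u w v = 2 * fderiv ℝ (leviMetric φ) z u v w := by
  simp only [lowChern_apply]
  rw [hV.fderiv_leviMetric_symm hz u w v, hV.fderiv_leviMetric_symm hz (J u) w (J v),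
    hV.fderiv_leviMetric_J hz]
  ring

/-- Differentiation of an identity `dφ(X) = 0` along `V`. -/
theorem fderiv_apply_of_const (hV : IsFoliatedOn φ V) (hz : z ∈ V) {X : E → E} {X' : E →L[ℝ] E}
    (hX : HasFDerivAt X X' z) {c : ℝ} (hc : ∀ y ∈ V, fderiv ℝ φ y (X y) = c) (v : E) :
    hess φ z v (X z) + fderiv ℝ φ z (X' v) = 0 := by
  have h1 := (hV.smooth z hz).fderiv_infty.differentiableAt_infty.hasFDerivAt.clm_apply hX
  have h2 : HasFDerivAt (fun y => fderiv ℝ φ y (X y)) (0 : E →L[ℝ] ℝ) z :=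
    (hasFDerivAt_const c z).congr_of_eventuallyEq ((hV.eventually_mem hz).mono hc)
  have h3 := DFunLike.congr_fun (h1.unique h2) v
  simpa [hess, add_comm] using h3

variable [FiniteDimensional ℂ E]

theorem contDiffAt_normalField (hV : IsFoliatedOn φ V) (hz : z ∈ V) :
    ContDiffAt ℝ ∞ (normalField φ) z :=
  GrahamLee.contDiffAt_normalField (hV.smooth z hz) (hV.strict z hz)

theorem hasFDerivAt_normalField (hV : IsFoliatedOn φ V) (hz : z ∈ V) :
    HasFDerivAt (normalField φ) (fderiv ℝ (normalField φ) z) z :=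
  (hV.contDiffAt_normalField hz).differentiableAt_infty.hasFDerivAt

theorem fderiv_fderiv_normalField (hV : IsFoliatedOn φ V) (hz : z ∈ V) (v : E) :
    fderiv ℝ φ z (fderiv ℝ (normalField φ) z v) = -hess φ z v (normalField φ z) := by
  have := hV.fderiv_apply_of_const hz (hV.hasFDerivAt_normalField hz)
    (fun y hy => fderiv_normalField (hV.smooth y hy) (hV.strict y hy)) v
  linarith

theorem fderiv_J_fderiv_normalField (hV : IsFoliatedOn φ V) (hz : z ∈ V) (v : E) :
    fderiv ℝ φ z (J (fderiv ℝ (normalField φ) z v)) = -hess φ z v (J (normalField φ z)) := by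
  have := hV.fderiv_apply_of_const hz
    ((J : E →L[ℝ] E).hasFDerivAt.comp z (hV.hasFDerivAt_normalField hz))
    (fun y hy => fderiv_J_normalField (hV.smooth y hy) (hV.strict y hy)) v
  simp only [Function.comp_apply, ContinuousLinearMap.comp_apply] at this
  linarith

theorem contDiffAt_curvature (hV : IsFoliatedOn φ V) (hz : z ∈ V) :
    ContDiffAt ℝ ∞ (curvature φ) z :=
  ((contDiffAt_leviMetric (hV.smooth z hz)).clm_apply (hV.contDiffAt_normalField hz)).clm_apply
    (hV.contDiffAt_normalField hz)

/-- The derivative of the identity `G(N, ·) = (r / 2) dφ`. -/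
theorem leviMetric_fderiv_normalField (hV : IsFoliatedOn φ V) (hz : z ∈ V) (v c : E) :
    leviMetric φ z (fderiv ℝ (normalField φ) z v) c =
      1 / 2 * curvature φ z * hess φ z v c + 1 / 2 * fderiv ℝ φ z c * fderiv ℝ (curvature φ) z v -
        fderiv ℝ (leviMetric φ) z v (normalField φ z) c := by
  have hφ := hV.smooth z hz
  have h1 := ((contDiffAt_leviMetric hφ).differentiableAt_infty.hasFDerivAt.clm_apply
    (hV.hasFDerivAt_normalField hz)).clm_apply (hasFDerivAt_const c z)
  have h2 := ((hφ.fderiv_infty.differentiableAt_infty.hasFDerivAt.clm_apply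
    (hasFDerivAt_const c z)).const_mul (1 / 2 : ℝ)).mul
    (hV.contDiffAt_curvature hz).differentiableAt_infty.hasFDerivAt
  have h3 := h1.unique (h2.congr_of_eventuallyEq ((hV.eventually_mem hz).mono fun y hy =>
    leviMetric_normalField_left (hV.smooth y hy) (hV.strict y hy) c))
  have h4 := DFunLike.congr_fun h3 v
  simp at h4
  rw [hess]
  linarith

theorem fderiv_curvature (hV : IsFoliatedOn φ V) (hz : z ∈ V) (v : E) :
    fderiv ℝ (curvature φ) z v =
      fderiv ℝ (leviMetric φ) z v (normalField φ z) (normalField φ z) -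
        curvature φ z * hess φ z v (normalField φ z) := by
  have hφ := hV.smooth z hz
  have h := hV.strict z hz
  have h1 := hV.leviMetric_fderiv_normalField hz v (normalField φ z)
  rw [leviMetric_symm hφ, leviMetric_normalField_left hφ h, fderiv_normalField hφ h,
    hV.fderiv_fderiv_normalField hz] at h1
  linarith

end IsFoliatedOn

/-! ### The Chern connection of `G` on `H(𝓕)` -/

/-- The Chern connection form of the Hermitian metric `G` of `H(𝓕)`:
`G(chern(u, v), w) = K(u, v, w) / 2`. -/
def chern (φ : E → ℝ) (z : E) : E →L[ℝ] E →L[ℝ] E :=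
  (ContinuousLinearMap.compL ℝ E (E →L[ℝ] ℝ) E (horizontalDual φ z)).comp
    ((1 / 2 : ℝ) • lowChern φ z)

theorem chern_apply (φ : E → ℝ) (z u v : E) :
    chern φ z u v = horizontalDual φ z ((1 / 2 : ℝ) • lowChern φ z u v) := rfl

theorem IsFoliatedOn.chern_symm (hV : IsFoliatedOn φ V) (hz : z ∈ V) (u v : E) :
    chern φ z u v = chern φ z v u := by
  rw [chern_apply, chern_apply]
  congr 2
  ext w
  exact hV.lowChern_symm hz u v w

/-- The connection form of the Graham–Lee connection in the flat trivialisation of the tangent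
bundle: `connForm φ z w v` is `∇_v w` for the constant field `w`. With `η = dφ / 2` and
`ν(v) = π_H(D_v N)` it is
`-η(w) ν(v) - θ(w) J ν(v) + chern(v, π_H w) - r θ(v) J π_H w + (D_v θ)(w) T + (D_v η)(w) N`.
The terms in `ν`, `D θ`, `D η` make `N`, `T`, `H(𝓕)` parallel, and the skew term `-r θ(v) J` is what
the prescribed torsion `T_∇(N, W) = r W + i τ(W)` adds to the Chern connection. -/
def connForm (φ : E → ℝ) (z : E) : E →L[ℝ] E →L[ℝ] E :=
  (-(1 / 2 : ℝ) • fderiv ℝ φ z).smulRight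
      ((projHoriz φ z).comp (fderiv ℝ (normalField φ) z)) +
    ((1 / 2 : ℝ) • precompJ (fderiv ℝ φ z)).smulRight
      (J.comp ((projHoriz φ z).comp (fderiv ℝ (normalField φ) z))) +
    (chern φ z).flip.comp (projHoriz φ z) +
    (ContinuousLinearMap.smulRightL ℝ E E ((1 / 2 : ℝ) • precompJ (fderiv ℝ φ z))).comp
      (curvature φ z • J.comp (projHoriz φ z)) -
    ((ContinuousLinearMap.smulRightL ℝ E E).flip (J (normalField φ z))).comp
      ((1 / 2 : ℝ) • (hess φ z).flip.comp J) +
    ((ContinuousLinearMap.smulRightL ℝ E E).flip (normalField φ z)).comp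
      ((1 / 2 : ℝ) • (hess φ z).flip)

theorem connForm_apply (φ : E → ℝ) (z w v : E) :
    connForm φ z w v =
      (-(1 / 2) * fderiv ℝ φ z w) • projHoriz φ z (fderiv ℝ (normalField φ) z v) +
      (1 / 2 * fderiv ℝ φ z (J w)) • J (projHoriz φ z (fderiv ℝ (normalField φ) z v)) +
      chern φ z v (projHoriz φ z w) +
      (1 / 2 * fderiv ℝ φ z (J v)) • curvature φ z • J (projHoriz φ z w) -
      (1 / 2 * hess φ z v (J w)) • J (normalField φ z) +
      (1 / 2 * hess φ z v w) • normalField φ z := rfl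

/-- The Graham–Lee connection `∇ = D + connForm`. -/
def grahamLee (φ : E → ℝ) : ConnectionOperator E := fun X z => fderiv ℝ X z + connForm φ z (X z)

theorem grahamLee_apply (φ : E → ℝ) (X : E → E) (z v : E) :
    grahamLee φ X z v = fderiv ℝ X z v + connForm φ z (X z) v := rfl

theorem connForm_of_mem {w : E} (hw : w ∈ horizontal φ z) (v : E) :
    connForm φ z w v = chern φ z v w + (1 / 2 * fderiv ℝ φ z (J v)) • curvature φ z • J w -
      (1 / 2 * hess φ z v (J w)) • J (normalField φ z) +
      (1 / 2 * hess φ z v w) • normalField φ z := by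
  rw [connForm_apply, projHoriz_of_mem hw, hw.1, hw.2]
  simp

theorem IsFoliatedOn.connForm_torsion_horizontal (hV : IsFoliatedOn φ V) (hz : z ∈ V) {a b : E}
    (ha : a ∈ horizontal φ z) (hb : b ∈ horizontal φ z) :
    connForm φ z b a - connForm φ z a b =
      (2 * leviMetric φ z (J a) b) • J (normalField φ z) := by
  have hφ := hV.smooth z hz
  rw [connForm_of_mem ha, connForm_of_mem hb, ha.2, hb.2, hV.chern_symm hz, hess_symm hφ b a,
    leviMetric_apply, hess_symm hφ b (J a), J_J, map_neg]
  simp only [neg_apply]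
  module

variable [FiniteDimensional ℂ E]

namespace IsFoliatedOn

theorem chern_mem (hV : IsFoliatedOn φ V) (hz : z ∈ V) (u v : E) :
    chern φ z u v ∈ horizontal φ z :=
  horizontalDual_mem (hV.smooth z hz) (hV.strict z hz) _

theorem leviMetric_chern (hV : IsFoliatedOn φ V) (hz : z ∈ V) (u v : E) {c : E}
    (hc : c ∈ horizontal φ z) :
    leviMetric φ z (chern φ z u v) c = 1 / 2 * lowChern φ z u v c := by
  rw [chern_apply, leviMetric_horizontalDual (hV.smooth z hz) (hV.strict z hz) _ hc]
  rfl

theorem chern_J (hV : IsFoliatedOn φ V) (hz : z ∈ V) (u v : E) :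
    chern φ z u (J v) = J (chern φ z u v) := by
  refine eq_of_leviMetric_eq (hV.smooth z hz) (hV.strict z hz) (hV.chern_mem hz _ _)
    (J_mem_horizontal (hV.chern_mem hz _ _)) fun c hc => ?_
  rw [hV.leviMetric_chern hz _ _ hc, leviMetric_J_left,
    hV.leviMetric_chern hz _ _ (J_mem_horizontal hc), hV.lowChern_J_mid hz]
  ring

theorem connForm_J (hV : IsFoliatedOn φ V) (hz : z ∈ V) (w v : E) :
    connForm φ z (J w) v = J (connForm φ z w v) := by
  simp only [connForm_apply, projHoriz_J, J_J, map_neg, map_add, map_sub, map_smul,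
    hV.chern_J hz]
  module

theorem connForm_normalField (hV : IsFoliatedOn φ V) (hz : z ∈ V) (v : E) :
    connForm φ z (normalField φ z) v = -fderiv ℝ (normalField φ) z v := by
  have hφ := hV.smooth z hz
  have h := hV.strict z hz
  have h1 := eq_projHoriz_add φ z (fderiv ℝ (normalField φ) z v)
  rw [hV.fderiv_fderiv_normalField hz, hV.fderiv_J_fderiv_normalField hz] at h1
  conv_rhs => rw [h1]
  rw [connForm_apply, projHoriz_normalField hφ h, fderiv_normalField hφ h,
    fderiv_J_normalField hφ h]
  simp only [map_zero, smul_zero]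
  module

theorem connForm_J_normalField (hV : IsFoliatedOn φ V) (hz : z ∈ V) (v : E) :
    connForm φ z (J (normalField φ z)) v = -J (fderiv ℝ (normalField φ) z v) := by
  rw [hV.connForm_J hz, hV.connForm_normalField hz, map_neg]

theorem leviMetric_connForm (hV : IsFoliatedOn φ V) (hz : z ∈ V) {a c : E}
    (ha : a ∈ horizontal φ z) (hc : c ∈ horizontal φ z) (v : E) :
    leviMetric φ z (connForm φ z a v) c = 1 / 2 * lowChern φ z v a c +
      1 / 2 * fderiv ℝ φ z (J v) * curvature φ z * leviMetric φ z (J a) c := by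
  have hφ := hV.smooth z hz
  have h := hV.strict z hz
  rw [connForm_of_mem ha, ← hV.leviMetric_chern hz _ _ hc]
  simp [leviMetric_normalField hφ h hc, leviMetric_J_left φ z (normalField φ z),
    leviMetric_normalField hφ h (J_mem_horizontal hc)]
  ring

/-- `∇` is metric: the connection form accounts for the derivative of `G` on `H(𝓕)`. -/
theorem leviMetric_connForm_add (hV : IsFoliatedOn φ V) (hz : z ∈ V) {a b : E}
    (ha : a ∈ horizontal φ z) (hb : b ∈ horizontal φ z) (v : E) :
    leviMetric φ z (connForm φ z a v) b + leviMetric φ z a (connForm φ z b v) =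
      fderiv ℝ (leviMetric φ) z v a b := by
  have hφ := hV.smooth z hz
  rw [leviMetric_symm hφ a, hV.leviMetric_connForm hz ha hb, hV.leviMetric_connForm hz hb ha,
    leviMetric_J_left φ z b a, leviMetric_symm hφ b]
  linear_combination 1 / 2 * hV.lowChern_add_swap hz v a b

/-! ### The torsion of the Graham–Lee connection -/

/-- The endomorphism `-J τ` of `H(𝓕)`, where `τ` is the pseudohermitian torsion. -/
def torsionEndo (φ : E → ℝ) (z b : E) : E :=
  projHoriz φ z (fderiv ℝ (normalField φ) z b) + chern φ z (normalField φ z) b - curvature φ z • b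

theorem torsionEndo_mem (hV : IsFoliatedOn φ V) (hz : z ∈ V) {b : E} (hb : b ∈ horizontal φ z) :
    torsionEndo φ z b ∈ horizontal φ z :=
  sub_mem (add_mem (projHoriz_mem (hV.smooth z hz) (hV.strict z hz) _) (hV.chern_mem hz _ _))
    (Submodule.smul_mem _ _ hb)

theorem leviMetric_torsionEndo (hV : IsFoliatedOn φ V) (hz : z ∈ V) {b c : E}
    (hc : c ∈ horizontal φ z) :
    leviMetric φ z (torsionEndo φ z b) c =
      1 / 4 * curvature φ z * (hess φ z b c - hess φ z (J b) (J c)) -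
      1 / 2 * (fderiv ℝ (leviMetric φ) z b (normalField φ z) c -
        fderiv ℝ (leviMetric φ) z (J b) (normalField φ z) (J c)) := by
  have hφ := hV.smooth z hz
  have h := hV.strict z hz
  rw [torsionEndo, ContinuousLinearMap.map_sub₂, ContinuousLinearMap.map_add₂,
    leviMetric_projHoriz_left hφ h _ hc, hV.leviMetric_fderiv_normalField hz, hc.1,
    hV.leviMetric_chern hz _ _ hc, hV.lowChern_symm hz, lowChern_apply, map_smul, smul_apply,
    leviMetric_apply, smul_eq_mul]
  ring

/-- The endomorphism `-J τ` is antilinear, so that `τ` maps `T_{1,0}(𝓕)` to `T_{0,1}(𝓕)`. -/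
theorem torsionEndo_J (hV : IsFoliatedOn φ V) (hz : z ∈ V) {b : E} (hb : b ∈ horizontal φ z) :
    torsionEndo φ z (J b) = -J (torsionEndo φ z b) := by
  refine eq_of_leviMetric_eq (hV.smooth z hz) (hV.strict z hz)
    (hV.torsionEndo_mem hz (J_mem_horizontal hb))
    (neg_mem (J_mem_horizontal (hV.torsionEndo_mem hz hb))) fun c hc => ?_
  rw [hV.leviMetric_torsionEndo hz hc, map_neg, neg_apply, leviMetric_J_left,
    hV.leviMetric_torsionEndo hz (J_mem_horizontal hc)]
  simp only [J_J, map_neg, neg_apply]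
  ring

theorem connForm_torsion_T (hV : IsFoliatedOn φ V) (hz : z ∈ V) {b : E}
    (hb : b ∈ horizontal φ z) :
    connForm φ z b (J (normalField φ z)) - connForm φ z (J (normalField φ z)) b =
      J (torsionEndo φ z b) := by
  have hφ := hV.smooth z hz
  have h := hV.strict z hz
  have h1 := eq_projHoriz_add φ z (fderiv ℝ (normalField φ) z b)
  rw [hV.fderiv_fderiv_normalField hz, hV.fderiv_J_fderiv_normalField hz] at h1
  have h2 := leviMetric_normalField hφ h hb
  rw [leviMetric_apply] at h2
  rw [hV.connForm_J_normalField hz, h1, connForm_of_mem hb, hV.chern_symm hz, hV.chern_J hz,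
    torsionEndo, hV.chern_symm hz _ b, J_J, map_neg, fderiv_normalField hφ h,
    hess_symm hφ (J (normalField φ z)) b,
    show hess φ z (J (normalField φ z)) (J b) = -hess φ z b (normalField φ z) by
      rw [hess_symm hφ b]; linarith]
  simp only [map_add, map_sub, map_smul, J_J]
  module

theorem connForm_torsion_N (hV : IsFoliatedOn φ V) (hz : z ∈ V) {b : E}
    (hb : b ∈ horizontal φ z) :
    connForm φ z b (normalField φ z) - connForm φ z (normalField φ z) b =
      torsionEndo φ z b + curvature φ z • b := by
  have hφ := hV.smooth z hz
  have h := hV.strict z hz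
  have h1 := eq_projHoriz_add φ z (fderiv ℝ (normalField φ) z b)
  rw [hV.fderiv_fderiv_normalField hz, hV.fderiv_J_fderiv_normalField hz] at h1
  have h2 := leviMetric_normalField hφ h (J_mem_horizontal hb)
  rw [leviMetric_apply, J_J, map_neg] at h2
  rw [hV.connForm_normalField hz, h1, connForm_of_mem hb,
    torsionEndo, fderiv_J_normalField hφ h, hess_symm hφ _ b,
    show hess φ z (normalField φ z) (J b) = hess φ z b (J (normalField φ z)) by
      rw [hess_symm hφ b]; linarith]
  module

/-- The bracket `[N, T] = -J ∇ᴴ r - 2 r T`, which equals `T_∇(T, N)` because `N` and `T` are parallel;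
here `x = ∇ᴴ r`. -/
theorem connForm_torsion_T_N (hV : IsFoliatedOn φ V) (hz : z ∈ V) {x : E}
    (hx : x ∈ horizontal φ z)
    (hgrad : ∀ c ∈ horizontal φ z, leviMetric φ z x c = fderiv ℝ (curvature φ) z c) :
    connForm φ z (normalField φ z) (J (normalField φ z)) -
        connForm φ z (J (normalField φ z)) (normalField φ z) =
      -J x - (2 * curvature φ z) • J (normalField φ z) := by
  have hφ := hV.smooth z hz
  have h := hV.strict z hz
  rw [hV.connForm_normalField hz, hV.connForm_J_normalField hz, sub_neg_eq_add]
  set N := normalField φ z with hN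
  set N' := fderiv ℝ (normalField φ) z with hN'
  have hr : curvature φ z = 1 / 4 * (hess φ z N N + hess φ z (J N) (J N)) :=
    leviMetric_apply _ _ _ _
  have hP : projHoriz φ z (-N' (J N) + J (N' N)) = -J x := by
    refine eq_of_leviMetric_eq hφ h (projHoriz_mem hφ h _) (neg_mem (J_mem_horizontal hx))
      fun c hc => ?_
    have hJc := J_mem_horizontal hc
    have h2 := leviMetric_normalField hφ h hJc
    rw [leviMetric_apply, J_J, map_neg, ← hN] at h2
    rw [leviMetric_projHoriz_left hφ h _ hc]
    simp only [map_add, map_neg, add_apply, neg_apply]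
    rw [leviMetric_J_left, leviMetric_J_left, hgrad _ hJc, hV.fderiv_curvature hz,
      hV.leviMetric_fderiv_normalField hz, hV.leviMetric_fderiv_normalField hz, hc.1, hc.2, ← hN,
      hess_symm hφ (J c) N]
    have hl := fderiv_hess_symm_left hφ
    have hs := fderiv_hess_symm_right (hV.eventually_smooth hz)
    have h3 : fderiv ℝ (leviMetric φ) z (J c) N N =
        fderiv ℝ (leviMetric φ) z N N (J c) + fderiv ℝ (leviMetric φ) z (J N) N c := by
      simp only [fderiv_leviMetric hφ, J_J, map_neg]
      rw [hl (J c) N N, hs N (J c) N, hl (J c) (J N) (J N), hs (J N) (J c) (J N), hl (J N) N c]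
      ring
    rw [h3]
    linear_combination (2 * curvature φ z) * h2
  rw [eq_projHoriz_add φ z (-N' (J N) + J (N' N)), hP]
  simp only [map_add, map_neg, J_J]
  rw [hV.fderiv_fderiv_normalField hz, hV.fderiv_J_fderiv_normalField hz,
    hV.fderiv_fderiv_normalField hz, hV.fderiv_J_fderiv_normalField hz, ← hN,
    hess_symm hφ (J N) N, hr]
  module

end IsFoliatedOn

end

section

variable {E : Type*} [NormedAddCommGroup E] [NormedSpace ℂ E]

variable {φ : E → ℝ} {V : Set E} {z : E}

/-! ### One-sided neighbourhoods of the boundary -/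

theorem IsStrictlyPseudoconvexDomain.contDiffAt {Ω U : Set E}
    (h : IsStrictlyPseudoconvexDomain Ω U φ) (hz : z ∈ U) : ContDiffAt ℝ ∞ φ z :=
  h.smooth.contDiffAt (h.isOpen_U.mem_nhds hz)

theorem IsFoliatedOneSidedNhd.isFoliatedOn {Ω U : Set E}
    (h : IsStrictlyPseudoconvexDomain Ω U φ) (hV : IsFoliatedOneSidedNhd Ω φ V) :
    IsFoliatedOn φ V where
  isOpen := hV.isOpen
  smooth _ hz := h.contDiffAt (h.closure_subset (subset_closure (hV.subset hz)))
  strict := hV.foliated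

section Openness

variable [FiniteDimensional ℂ E]

/-- Strict pseudoconvexity is an open condition, by compactness of the unit sphere. -/
theorem eventually_isStrictlyPseudoconvexAt (hφ : ∀ᶠ y in nhds z, ContDiffAt ℝ ∞ φ y)
    (h : IsStrictlyPseudoconvexAt φ z) : ∀ᶠ y in nhds z, IsStrictlyPseudoconvexAt φ y := by
  have := FiniteDimensional.proper ℝ E
  have h0 := hφ.self_of_nhds
  have hd : ContinuousAt (fderiv ℝ φ) z := h0.fderiv_infty.continuousAt
  have hG : ContinuousAt (leviMetric φ) z := (contDiffAt_leviMetric h0).continuousAt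
  have key : ∀ᶠ y in nhds z, ∀ w ∈ Metric.sphere (0 : E) 1,
      fderiv ℝ φ y w = 0 → fderiv ℝ φ y (J w) = 0 → 0 < leviMetric φ y w w := by
    refine (isCompact_sphere (0 : E) 1).eventually_forall_of_forall_eventually fun v hv => ?_
    have c1 : ContinuousAt (fun p : E × E => p.1) (z, v) := continuousAt_fst
    have c2 : ContinuousAt (fun p : E × E => p.2) (z, v) := continuousAt_snd
    have cd : ContinuousAt (fun p : E × E => fderiv ℝ φ p.1) (z, v) :=
      ContinuousAt.comp (x := (z, v)) (f := Prod.fst) hd c1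
    have cG : ContinuousAt (fun p : E × E => leviMetric φ p.1) (z, v) :=
      ContinuousAt.comp (x := (z, v)) (f := Prod.fst) hG c1
    have e1 := cd.clm_apply c2
    have e2 := cd.clm_apply (J.continuous.continuousAt.comp c2)
    have e3 := (cG.clm_apply c2).clm_apply c2
    by_cases h1 : fderiv ℝ φ z v = 0
    · by_cases h2 : fderiv ℝ φ z (J v) = 0
      · have hv0 : v ≠ 0 := by rintro rfl; simp at hv
        have h3 := ((isStrictlyPseudoconvexAt_iff h0).1 h).2 v ⟨h1, h2⟩ hv0
        filter_upwards [e3.eventually (lt_mem_nhds h3)] with p hp _ _ using hp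
      · filter_upwards [e2.eventually_ne h2] with p hp _ hp' using absurd hp' hp
    · filter_upwards [e1.eventually_ne h1] with p hp hp' using absurd hp' hp
  filter_upwards [key, hφ, hd.eventually_ne h.1] with y hy hφy hdy
  refine (isStrictlyPseudoconvexAt_iff hφy).2 ⟨hdy, fun a ha ha0 => ?_⟩
  -- positivity on the unit sphere extends to all nonzero vectors by homogeneity
  have hn : 0 < ‖a‖ := norm_pos_iff.2 ha0
  have hm : ‖a‖⁻¹ • a ∈ horizontal φ y := Submodule.smul_mem _ _ ha
  have h4 := hy (‖a‖⁻¹ • a) (by simp [norm_smul, hn.ne']) hm.1 hm.2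
  simp only [map_smul, smul_apply, smul_eq_mul] at h4
  have h5 : 0 < ‖a‖⁻¹ := inv_pos.2 hn
  exact pos_of_mul_pos_right (pos_of_mul_pos_right h4 h5.le) h5.le

theorem IsStrictlyPseudoconvexDomain.exists_isFoliatedOneSidedNhd {Ω U : Set E}
    (h : IsStrictlyPseudoconvexDomain Ω U φ) : ∃ V, IsFoliatedOneSidedNhd Ω φ V := by
  have hΩU : Ω ⊆ U := subset_closure.trans h.closure_subset
  have hO : IsOpen {z ∈ U | IsStrictlyPseudoconvexAt φ z} := by
    rw [isOpen_iff_mem_nhds]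
    rintro z ⟨hz, hs⟩
    have hU := h.isOpen_U.mem_nhds hz
    filter_upwards [hU, eventually_isStrictlyPseudoconvexAt
      (Filter.mem_of_superset hU fun y hy => h.contDiffAt hy) hs] with y h1 h2 using ⟨h1, h2⟩
  have hΩ : IsOpen Ω := by
    have h1 := h.smooth.continuousOn.isOpen_inter_preimage h.isOpen_U (isOpen_Iio (a := (0 : ℝ)))
    rw [h.eq_neg]
    exact h1
  exact ⟨_, hO.inter hΩ, Set.inter_subset_right, ⟨_, hO, fun z hz =>
    ⟨h.closure_subset (frontier_subset_closure hz), h.strict z hz⟩, subset_rfl⟩, fun z hz => hz.1.2⟩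

end Openness

/-! ### Linear connections on a vector space -/

theorem mdifferentiableAt_section_iff {X : Π z : E, TangentSpace 𝓘(ℝ, E) z} {z : E} :
    MDifferentiableAt 𝓘(ℝ, E) (𝓘(ℝ, E).prod 𝓘(ℝ, E))
      (fun y => (⟨y, X y⟩ : Bundle.TotalSpace E fun z : E => TangentSpace 𝓘(ℝ, E) z)) z ↔
      DifferentiableAt ℝ (F := E) X z := by
  refine (mdifferentiableAt_section (F := E) (IB := 𝓘(ℝ, E)) X).trans ?_
  refine Iff.trans ?_ (mdifferentiableAt_iff_differentiableAt (f := (X : E → E)))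
  have : (fun y => (trivializationAt E (fun z : E => TangentSpace 𝓘(ℝ, E) z) z ⟨y, X y⟩).2) =
      (X : E → E) := by
    ext y
    simp
    rfl
  exact iff_of_eq (congrArg (fun f : E → E => MDifferentiableAt 𝓘(ℝ, E) 𝓘(ℝ, E) f z) this)

theorem mvfderiv_eq {g : E → ℝ} {z : E} : mvfderiv 𝓘(ℝ, E) g z = fderiv ℝ g z := by
  ext v
  simp only [mvfderiv, mfderiv_eq_fderiv]
  rfl

/-- The flat connection of a vector space, given by the Fréchet derivative of vector fields. -/
theorem isCovariantDerivativeOn_fderiv (V : Set E) :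
    IsCovariantDerivativeOn (I := 𝓘(ℝ, E)) (V := fun z : E => TangentSpace 𝓘(ℝ, E) z) E
      (fun X z => fderiv ℝ (X : E → E) z) V where
  add hX hY _ :=
    fderiv_add (mdifferentiableAt_section_iff.1 hX) (mdifferentiableAt_section_iff.1 hY)
  leibniz hX hg _ := by
    rw [mvfderiv_eq]
    exact fderiv_smul (hg.differentiableAt) (mdifferentiableAt_section_iff.1 hX)

theorem isCovariantDerivativeOn_grahamLee (φ : E → ℝ) (V : Set E) :
    IsCovariantDerivativeOn (I := 𝓘(ℝ, E)) (V := fun z : E => TangentSpace 𝓘(ℝ, E) z) E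
      (grahamLee φ) V :=
  (isCovariantDerivativeOn_fderiv V).add_one_form (connForm φ)

/-! ### Sections of `T_{1,0}(𝓕)` and the gradient of the transverse curvature -/

namespace IsSectionT10

variable {Z : E → CTangent E}

theorem eq_typeTen (hZ : IsSectionT10 φ V Z) (hz : z ∈ V) : Z z = typeTen (Z z).re :=
  (mem_T10_iff.1 (hZ.2.2 z hz)).1

theorem im_eq (hZ : IsSectionT10 φ V Z) (hz : z ∈ V) : (Z z).im = -J (Z z).re :=
  congrArg CTangent.im (hZ.eq_typeTen hz)

theorem re_mem (hZ : IsSectionT10 φ V Z) (hz : z ∈ V) : (Z z).re ∈ horizontal φ z :=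
  (mem_T10_iff.1 (hZ.2.2 z hz)).2

theorem hasFDerivAt_re (hZ : IsSectionT10 φ V Z) (hV : IsOpen V) (hz : z ∈ V) :
    HasFDerivAt (fun y => (Z y).re) (fderiv ℝ (fun y => (Z y).re) z) z :=
  (hZ.1.contDiffAt (hV.mem_nhds hz)).differentiableAt_infty.hasFDerivAt

theorem fderiv_im (hZ : IsSectionT10 φ V Z) (hV : IsOpen V) (hz : z ∈ V) (v : E) :
    fderiv ℝ (fun y => (Z y).im) z v = -J (fderiv ℝ (fun y => (Z y).re) z v) := by
  have h1 : (fun y => (Z y).im) =ᶠ[nhds z] fun y => -J (Z y).re := by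
    filter_upwards [hV.mem_nhds hz] with y hy using hZ.im_eq hy
  have h2 := ((J : E →L[ℝ] E).hasFDerivAt.comp z (hZ.hasFDerivAt_re hV hz)).neg
  rw [h1.fderiv_eq]
  exact DFunLike.congr_fun h2.fderiv v

end IsSectionT10

/-- The torsion of the Graham–Lee connection as a tensor, `connTorsion φ z v w = T_∇(v, w)`. -/
def connTorsion (φ : E → ℝ) (z v w : E) : E := connForm φ z w v - connForm φ z v w

theorem torsion_grahamLee (φ : E → ℝ) (X Y : E → E) (z : E) :
    torsion (grahamLee φ) X Y z = connTorsion φ z (X z) (Y z) := by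
  rw [torsion, grahamLee_apply, grahamLee_apply, VectorField.lieBracket, connTorsion]
  abel

theorem IsFoliatedOn.contDiffAt_lowChern (hV : IsFoliatedOn φ V) (hz : z ∈ V) {X Y : E → E}
    (hX : ContDiffAt ℝ ∞ X z) (hY : ContDiffAt ℝ ∞ Y z) :
    ContDiffAt ℝ ∞ (fun y => lowChern φ y (X y) (Y y)) z := by
  have h1 := (contDiffAt_leviMetric (hV.smooth z hz)).fderiv_infty
  have h2 := (h1.clm_apply hX).clm_apply hY
  have h3 := (h1.clm_apply ((contDiffAt_const (c := (J : E →L[ℝ] E))).clm_apply hX)).clm_apply hY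
  exact h2.add (h3.clm_comp (contDiffAt_const (c := (J : E →L[ℝ] E))))

variable [FiniteDimensional ℂ E]

namespace IsFoliatedOn

theorem fieldN_eq (hV : IsFoliatedOn φ V) (hz : z ∈ V) : fieldN φ z = normalField φ z :=
  GrahamLee.fieldN_eq (hV.smooth z hz) (hV.strict z hz)

theorem fieldT_eq (hV : IsFoliatedOn φ V) (hz : z ∈ V) : fieldT φ z = J (normalField φ z) :=
  GrahamLee.fieldT_eq (hV.smooth z hz) (hV.strict z hz)

theorem transverseCurvature_eq (hV : IsFoliatedOn φ V) (hz : z ∈ V) :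
    transverseCurvature φ z = curvature φ z :=
  GrahamLee.transverseCurvature_eq (hV.smooth z hz) (hV.strict z hz)

theorem hasFDerivAt_fieldN (hV : IsFoliatedOn φ V) (hz : z ∈ V) :
    HasFDerivAt (fieldN φ) (fderiv ℝ (normalField φ) z) z :=
  (hV.hasFDerivAt_normalField hz).congr_of_eventuallyEq
    ((hV.eventually_mem hz).mono fun _ hy => hV.fieldN_eq hy)

theorem hasFDerivAt_fieldT (hV : IsFoliatedOn φ V) (hz : z ∈ V) :
    HasFDerivAt (fieldT φ) ((J : E →L[ℝ] E).comp (fderiv ℝ (normalField φ) z)) z :=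
  ((J : E →L[ℝ] E).hasFDerivAt.comp z (hV.hasFDerivAt_normalField hz)).congr_of_eventuallyEq
    ((hV.eventually_mem hz).mono fun _ hy => hV.fieldT_eq hy)

theorem projH_eq (hV : IsFoliatedOn φ V) (hz : z ∈ V) {v : E} (hv : v ∈ leafTangent φ z) :
    projH φ z v = projHoriz φ z v := by
  have hv' : fderiv ℝ φ z v = 0 := hv
  rw [projH, projHoriz_apply, theta_re, hV.fieldT_eq hz, hv']
  module

theorem gTheta_eq (hV : IsFoliatedOn φ V) (hz : z ∈ V) {v w : E} (hv : v ∈ leafTangent φ z)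
    (hw : w ∈ leafTangent φ z) :
    gTheta φ z v w = leviMetric φ z (projHoriz φ z v) (projHoriz φ z w) +
      1 / 4 * (fderiv ℝ φ z (J v) * fderiv ℝ φ z (J w)) := by
  rw [gTheta, hV.projH_eq hz hv, hV.projH_eq hz hw, ← J_apply, dtheta_eq (hV.smooth z hz),
    Complex.ofReal_re, leviMetric_J_left, J_J, map_neg, neg_neg, theta_re, theta_re]
  ring

theorem tangentialGradR_spec (hV : IsFoliatedOn φ V) (hz : z ∈ V) :
    tangentialGradR φ z ∈ leafTangent φ z ∧ ∀ w ∈ leafTangent φ z,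
      gTheta φ z (tangentialGradR φ z) w = fderiv ℝ (transverseCurvature φ) z w := by
  have hφ := hV.smooth z hz
  have h := hV.strict z hz
  refine Classical.epsilon_spec (p := fun v : E => v ∈ leafTangent φ z ∧
    ∀ w ∈ leafTangent φ z, gTheta φ z v w = fderiv ℝ (transverseCurvature φ) z w) ?_
  set l := fderiv ℝ (transverseCurvature φ) z with hl
  have hx := horizontalDual_mem hφ h l
  set x := horizontalDual φ z l with hxdef
  have hm : x + l (J (normalField φ z)) • J (normalField φ z) ∈ leafTangent φ z := by
    change fderiv ℝ φ z _ = 0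
    simp [hx.1, fderiv_J_normalField hφ h]
  -- the gradient is the sum of its `H(𝓕)`-part `x` and of `T(r) T`
  refine ⟨_, hm, fun w hw => ?_⟩
  have hw' : fderiv ℝ φ z w = 0 := hw
  rw [hV.gTheta_eq hz hm hw]
  conv_rhs => rw [eq_projHoriz_add φ z w, hw']
  simp only [map_add, map_smul, projHoriz_of_mem hx, projHoriz_J_normalField hφ h, smul_zero,
    add_zero, J_J, map_neg, hx.2, fderiv_normalField hφ h, map_sub, mul_zero, zero_smul]
  rw [leviMetric_horizontalDual hφ h l (projHoriz_mem hφ h w)]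
  simp only [smul_eq_mul]
  ring

theorem gradHR_mem (hV : IsFoliatedOn φ V) (hz : z ∈ V) : gradHR φ z ∈ horizontal φ z := by
  rw [gradHR, hV.projH_eq hz (hV.tangentialGradR_spec hz).1]
  exact projHoriz_mem (hV.smooth z hz) (hV.strict z hz) _

theorem leviMetric_gradHR (hV : IsFoliatedOn φ V) (hz : z ∈ V) {c : E}
    (hc : c ∈ horizontal φ z) :
    leviMetric φ z (gradHR φ z) c = fderiv ℝ (curvature φ) z c := by
  obtain ⟨h1, h2⟩ := hV.tangentialGradR_spec hz
  have h3 := h2 c hc.1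
  have h4 : transverseCurvature φ =ᶠ[nhds z] curvature φ :=
    (hV.eventually_mem hz).mono fun _ hy => hV.transverseCurvature_eq hy
  rw [hV.gTheta_eq hz h1 hc.1, h4.fderiv_eq, hc.2, projHoriz_of_mem hc] at h3
  rw [gradHR, hV.projH_eq hz h1, ← h3]
  ring

/-! ### The Graham–Lee connection satisfies its axioms -/

theorem contDiffAt_chern (hV : IsFoliatedOn φ V) (hz : z ∈ V) {X Y : E → E}
    (hX : ContDiffAt ℝ ∞ X z) (hY : ContDiffAt ℝ ∞ Y z) :
    ContDiffAt ℝ ∞ (fun y => chern φ y (X y) (Y y)) z :=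
  (contDiffAt_horizontalDual (hV.smooth z hz) (hV.strict z hz)).clm_apply
    ((hV.contDiffAt_lowChern hz hX hY).const_smul (1 / 2 : ℝ))

theorem contDiffAt_connForm (hV : IsFoliatedOn φ V) (hz : z ∈ V) {X Y : E → E}
    (hX : ContDiffAt ℝ ∞ X z) (hY : ContDiffAt ℝ ∞ Y z) :
    ContDiffAt ℝ ∞ (fun y => connForm φ y (Y y) (X y)) z := by
  have hφ := hV.smooth z hz
  have hJ {W : E → E} (hW : ContDiffAt ℝ ∞ W z) : ContDiffAt ℝ ∞ (fun y => J (W y)) z :=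
    (contDiffAt_const (c := (J : E →L[ℝ] E))).clm_apply hW
  have hd {W : E → E} (hW : ContDiffAt ℝ ∞ W z) : ContDiffAt ℝ ∞ (fun y => fderiv ℝ φ y (W y)) z :=
    hφ.fderiv_infty.clm_apply hW
  have hh {W : E → E} (hW : ContDiffAt ℝ ∞ W z) :
      ContDiffAt ℝ ∞ (fun y => hess φ y (X y) (W y)) z :=
    ((contDiffAt_hess hφ).clm_apply hX).clm_apply hW
  have hN := hV.contDiffAt_normalField hz
  have hP := contDiffAt_projHoriz hφ (hV.strict z hz)
  have hν := hP.clm_apply (hN.fderiv_infty.clm_apply hX)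
  have hPY := hP.clm_apply hY
  simp only [connForm_apply]
  exact (((((contDiffAt_const.mul (hd hY)).smul hν).add
    ((contDiffAt_const.mul (hd (hJ hY))).smul (hJ hν))).add (hV.contDiffAt_chern hz hX hPY)).add
    ((contDiffAt_const.mul (hd (hJ hX))).smul ((hV.contDiffAt_curvature hz).smul (hJ hPY)))).sub
    ((contDiffAt_const.mul (hh (hJ hY))).smul (hJ hN)) |>.add
    ((contDiffAt_const.mul (hh hY)).smul hN)

theorem isLinearConnectionOn_grahamLee (hV : IsFoliatedOn φ V) :
    IsLinearConnectionOn (grahamLee φ) V where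
  isCovariantDerivativeOn := isCovariantDerivativeOn_grahamLee φ V
  smooth X Y hX hY z hz := by
    have hX' := hX.contDiffAt (hV.isOpen.mem_nhds hz)
    have hY' := hY.contDiffAt (hV.isOpen.mem_nhds hz)
    exact ((hY'.fderiv_infty.clm_apply hX').add
      (hV.contDiffAt_connForm hz hX' hY')).contDiffWithinAt

theorem grahamLee_mem_horizontal (hV : IsFoliatedOn φ V) (hz : z ∈ V) {X : E → E}
    (hX : DifferentiableAt ℝ X z) (hm : ∀ y ∈ V, X y ∈ horizontal φ y) (v : E) :
    grahamLee φ X z v ∈ horizontal φ z := by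
  have hφ := hV.smooth z hz
  have h := hV.strict z hz
  have h1 := hV.fderiv_apply_of_const hz hX.hasFDerivAt (fun y hy => (hm y hy).1) v
  have h2 := hV.fderiv_apply_of_const hz ((J : E →L[ℝ] E).hasFDerivAt.comp z hX.hasFDerivAt)
    (fun y hy => (hm y hy).2) v
  simp only [Function.comp_apply, ContinuousLinearMap.comp_apply] at h2
  have hc := hV.chern_mem hz v (X z)
  have hXm := hm z hz
  rw [grahamLee_apply, connForm_of_mem hXm, mem_horizontal]
  simp only [map_add, map_sub, map_smul, J_J, map_neg, hc.1, hc.2, hXm.1, hXm.2,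
    fderiv_normalField hφ h, fderiv_J_normalField hφ h, smul_eq_mul]
  constructor <;> linarith

/-- The Leibniz rule for `G` on sections of `H(𝓕)`: the derivative of `G(X, Y)` is
`G(∇X, Y) + G(X, ∇Y)`. -/
theorem hasFDerivAt_leviMetric_apply (hV : IsFoliatedOn φ V) (hz : z ∈ V) {X Y : E → E}
    {X' Y' : E →L[ℝ] E} (hX : HasFDerivAt X X' z) (hY : HasFDerivAt Y Y' z)
    (hXm : X z ∈ horizontal φ z) (hYm : Y z ∈ horizontal φ z) :
    HasFDerivAt (fun y => leviMetric φ y (X y) (Y y))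
      ((leviMetric φ z).flip (Y z) ∘L (X' + connForm φ z (X z)) +
        (leviMetric φ z) (X z) ∘L (Y' + connForm φ z (Y z))) z := by
  have h1 := ((contDiffAt_leviMetric (hV.smooth z hz)).differentiableAt_infty.hasFDerivAt.clm_apply
    hX).clm_apply hY
  refine h1.congr_fderiv ?_
  ext v
  have h2 := hV.leviMetric_connForm_add hz hXm hYm v
  simp
  linarith

theorem covC_grahamLee (hV : IsFoliatedOn φ V) {Z : E → CTangent E} (hZ : IsSectionT10 φ V Z)
    (hz : z ∈ V) (v : E) :
    covC (grahamLee φ) Z z v = typeTen (grahamLee φ (fun y => (Z y).re) z v) := by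
  ext1
  · rfl
  · change grahamLee φ (fun y => (Z y).im) z v = -J (grahamLee φ (fun y => (Z y).re) z v)
    rw [grahamLee_apply, grahamLee_apply, hZ.fderiv_im hV.isOpen hz, hZ.im_eq hz, map_neg,
      neg_apply, hV.connForm_J hz, map_add, neg_add]

theorem covC_conj_grahamLee (hV : IsFoliatedOn φ V) {Z : E → CTangent E}
    (hZ : IsSectionT10 φ V Z) (hz : z ∈ V) (v : E) :
    covC (grahamLee φ) (fun y => conj (Z y)) z v =
      conj (typeTen (grahamLee φ (fun y => (Z y).re) z v)) := by
  rw [← hV.covC_grahamLee hZ hz]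
  ext1
  · rfl
  · change grahamLee φ (fun y => -(Z y).im) z v = -grahamLee φ (fun y => (Z y).im) z v
    rw [grahamLee_apply, grahamLee_apply, map_neg, neg_apply, neg_add, fderiv_fun_neg, neg_apply]

theorem parallel_levi_grahamLee (hV : IsFoliatedOn φ V) {Z W : E → CTangent E}
    (hZ : IsSectionT10 φ V Z) (hW : IsSectionT10 φ V W) (hz : z ∈ V) (v : E) :
    fderiv ℝ (fun y => levi φ y (Z y) (conj (W y))) z v
      = levi φ z (covC (grahamLee φ) Z z v) (conj (W z))
        + levi φ z (Z z) (covC (grahamLee φ) (fun y => conj (W y)) z v) := by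
  have hφ := hV.smooth z hz
  have hZ' := hZ.hasFDerivAt_re hV.isOpen hz
  have hW' := hW.hasFDerivAt_re hV.isOpen hz
  have hJ' := (J : E →L[ℝ] E).hasFDerivAt.comp z hZ'
  have h1 := hV.hasFDerivAt_leviMetric_apply hz hZ' hW' (hZ.re_mem hz) (hW.re_mem hz)
  have h2 := hV.hasFDerivAt_leviMetric_apply hz hJ' hW' (J_mem_horizontal (hZ.re_mem hz))
    (hW.re_mem hz)
  have h3 := (Complex.ofRealCLM.hasFDerivAt.comp z (h1.const_mul 2)).sub
    ((Complex.ofRealCLM.hasFDerivAt.comp z (h2.const_mul 2)).const_mul Complex.I)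
  have h4 : (fun y => levi φ y (Z y) (conj (W y))) =ᶠ[nhds z] fun y =>
      ((2 * leviMetric φ y (Z y).re (W y).re : ℝ) : ℂ) -
        Complex.I * ((2 * leviMetric φ y (J (Z y).re) (W y).re : ℝ) : ℂ) := by
    filter_upwards [hV.eventually_mem hz] with y hy
    rw [hZ.eq_typeTen hy, hW.eq_typeTen hy, levi_typeTen (hV.smooth y hy)]
    rfl
  rw [h4.fderiv_eq, hV.covC_grahamLee hZ hz, hV.covC_conj_grahamLee hW hz, hW.eq_typeTen hz,
    hZ.eq_typeTen hz, levi_typeTen hφ, levi_typeTen hφ]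
  refine (DFunLike.congr_fun h3.fderiv v).trans ?_
  simp only [grahamLee_apply]
  simp [hV.connForm_J hz]
  ring

end IsFoliatedOn

end

section

/-! ### Purity of the torsion -/

namespace CTangent

section

variable {E : Type*} [NormedAddCommGroup E]

theorem zero_re : (0 : CTangent E).re = 0 := rfl

theorem zero_im : (0 : CTangent E).im = 0 := rfl

theorem add_re (v w : CTangent E) : (v + w).re = v.re + w.re := rfl

theorem add_im (v w : CTangent E) : (v + w).im = v.im + w.im := rfl

end

variable {E : Type*} [NormedAddCommGroup E] [NormedSpace ℂ E]

theorem smul_re (c : ℂ) (v : CTangent E) : (c • v).re = c.re • v.re - c.im • v.im := rfl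

theorem smul_im (c : ℂ) (v : CTangent E) : (c • v).im = c.re • v.im + c.im • v.re := rfl

end CTangent

variable {E : Type*} [NormedAddCommGroup E] [NormedSpace ℂ E]

variable {φ : E → ℝ} {V : Set E} {z : E}

theorem IsFoliatedOn.connTorsion_horizontal (hV : IsFoliatedOn φ V) (hz : z ∈ V) {a b : E}
    (ha : a ∈ horizontal φ z) (hb : b ∈ horizontal φ z) :
    connTorsion φ z a b = (2 * leviMetric φ z (J a) b) • J (normalField φ z) :=
  hV.connForm_torsion_horizontal hz ha hb

/-- The smooth section of `T_{1,0}(𝓕)` obtained by projecting a constant vector field. -/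
def projSection (φ : E → ℝ) (a : E) (y : E) : CTangent E :=
  typeTen (projHoriz φ y a)

theorem projSection_of_mem {a : E} (ha : a ∈ horizontal φ z) : projSection φ a z = typeTen a := by
  rw [projSection, projHoriz_of_mem ha]

/-- A form which is symmetric in its first two arguments and skew in its last two vanishes. -/
theorem eq_zero_of_skew_of_symm {S : Type*} {t : S → S → S → ℝ}
    (hs : ∀ a b c, t a b c = t b a c) (hk : ∀ a b c, t a b c = -t a c b) (a b c : S) :
    t a b c = 0 := by
  have := hs a b c
  have := hk b a c
  have := hs b c a
  have := hk c b a
  have := hs c a b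
  have := hk a c b
  linarith

variable [FiniteDimensional ℂ E]

namespace IsFoliatedOn

/-- The four torsion identities for `connForm` are the real form of purity. -/
theorem isPure_grahamLee (hV : IsFoliatedOn φ V) : IsPure φ V (grahamLee φ) where
  torsion_Z_W Z W hZ hW z hz := by
    have ha := hZ.re_mem hz
    have hb := hW.re_mem hz
    have hS {a b : E} := hV.connTorsion_horizontal (a := a) (b := b) hz
    ext1 <;> simp only [torsionC, torsion_grahamLee, hZ.im_eq hz, hW.im_eq hz]
    · rw [hS ha hb, hS (neg_mem (J_mem_horizontal ha)) (neg_mem (J_mem_horizontal hb))]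
      simp [leviMetric_J_left, CTangent.zero_re]
    · rw [hS ha (neg_mem (J_mem_horizontal hb)), hS (neg_mem (J_mem_horizontal ha)) hb]
      simp [leviMetric_J_left, CTangent.zero_im]
  torsion_Z_Wbar Z W hZ hW z hz := by
    have ha := hZ.re_mem hz
    have hb := hW.re_mem hz
    have hS {a b : E} := hV.connTorsion_horizontal (a := a) (b := b) hz
    have hL : 2 * Complex.I * levi φ z (Z z) (conj (W z)) =
        ⟨4 * leviMetric φ z (J (Z z).re) (W z).re, 4 * leviMetric φ z (Z z).re (W z).re⟩ := by
      rw [hZ.eq_typeTen hz, hW.eq_typeTen hz, levi_typeTen (hV.smooth z hz)]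
      apply Complex.ext
      · simp [typeTen]; ring
      · simp [typeTen]; ring
    rw [hL]
    ext1
    · simp only [torsionC, torsion_grahamLee, conj, hZ.im_eq hz, hW.im_eq hz, CTangent.smul_re,
        ofReal, neg_neg, smul_zero, sub_zero, hV.fieldT_eq hz]
      rw [hS ha hb, hS (neg_mem (J_mem_horizontal ha)) (J_mem_horizontal hb)]
      simp only [J_J, map_neg, neg_apply, leviMetric_J_left]
      module
    · simp only [torsionC, torsion_grahamLee, conj, hZ.im_eq hz, hW.im_eq hz, CTangent.smul_im,
        ofReal, neg_neg, smul_zero, zero_add, hV.fieldT_eq hz]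
      rw [hS ha (J_mem_horizontal hb), hS (neg_mem (J_mem_horizontal ha)) hb]
      simp only [J_J, map_neg, neg_apply, leviMetric_J_left]
      module
  torsion_N_W W hW z hz := by
    have hb := hW.re_mem hz
    have hJb := J_mem_horizontal hb
    have hF := hV.torsionEndo_J hz hb
    have h1 := hV.connForm_torsion_N hz hb
    have h2 := hV.connForm_torsion_N hz hJb
    have h3 := hV.connForm_torsion_T hz hb
    have h4 := hV.connForm_torsion_T hz hJb
    rw [hF] at h2 h4
    ext1
    · simp only [torsionC, tau, torsion_grahamLee, hW.im_eq hz, CTangent.smul_re,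
        CTangent.add_re, ofReal, hV.fieldT_eq hz, hV.fieldN_eq hz, hV.transverseCurvature_eq hz]
      simp only [connTorsion, map_neg, neg_apply, map_zero, zero_apply, Complex.ofReal_re,
        Complex.ofReal_im, Complex.I_re, Complex.I_im]
      rw [h1]
      have h5 := congrArg Neg.neg h4
      simp only [map_neg, J_J, neg_neg, neg_sub] at h5
      rw [show ∀ x y : E, -x - -y = y - x by intros; abel, h5]
      module
    · simp only [torsionC, tau, torsion_grahamLee, hW.im_eq hz, CTangent.smul_im,
        CTangent.add_im, ofReal, hV.fieldT_eq hz, hV.fieldN_eq hz, hV.transverseCurvature_eq hz]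
      simp only [connTorsion, map_neg, neg_apply, map_zero, zero_apply, Complex.ofReal_re,
        Complex.ofReal_im, Complex.I_re, Complex.I_im]
      rw [h3]
      have h5 := congrArg Neg.neg h2
      simp only [neg_sub] at h5
      rw [show ∀ x y : E, -x - -y = y - x by intros; abel, h5]
      module
  tau_T10 W hW z hz := by
    have hb := hW.re_mem hz
    have hJb := J_mem_horizontal hb
    have h3 := hV.connForm_torsion_T hz hb
    have h4 := hV.connForm_torsion_T hz hJb
    rw [hV.torsionEndo_J hz hb, map_neg, J_J, neg_neg] at h4
    have h5 : conj (tau φ (grahamLee φ) W z) = typeTen (J (torsionEndo φ z (W z).re)) := by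
      ext1
      · simp only [conj, typeTen, torsionC, tau, torsion_grahamLee, hW.im_eq hz, ofReal,
          hV.fieldT_eq hz]
        simp only [connTorsion, map_neg, map_zero, zero_apply]
        rw [h3]
        simp
      · simp only [conj, typeTen, torsionC, tau, torsion_grahamLee, hW.im_eq hz, ofReal,
          hV.fieldT_eq hz]
        simp only [connTorsion, map_neg, neg_apply, map_zero, zero_apply, J_J]
        rw [← h4]
        abel
    change conj (tau φ (grahamLee φ) W z) ∈ T10 φ z
    rw [h5, typeTen_mem_T10]
    exact J_mem_horizontal (hV.torsionEndo_mem hz hb)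
  tau_N z hz := by
    rw [torsion_grahamLee, hV.fieldT_eq hz, hV.fieldN_eq hz, hV.transverseCurvature_eq hz,
      connTorsion, hV.connForm_torsion_T_N hz (hV.gradHR_mem hz)
        (fun c hc => hV.leviMetric_gradHR hz hc), J_apply]

theorem isGrahamLeeConnection_grahamLee (hV : IsFoliatedOn φ V) :
    IsGrahamLeeConnection φ V (grahamLee φ) where
  isLinearConnectionOn := hV.isLinearConnectionOn_grahamLee
  parallel_T10 Z hZ z hz v := by
    rw [hV.covC_grahamLee hZ hz, typeTen_mem_T10]
    exact hV.grahamLee_mem_horizontal hz (hZ.hasFDerivAt_re hV.isOpen hz).differentiableAt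
      (fun y hy => hZ.re_mem hy) v
  parallel_levi Z W hZ hW z hz v := hV.parallel_levi_grahamLee hZ hW hz v
  parallel_T z hz := by
    ext v
    rw [grahamLee_apply, (hV.hasFDerivAt_fieldT hz).fderiv, hV.fieldT_eq hz,
      hV.connForm_J_normalField hz]
    simp
  parallel_N z hz := by
    ext v
    rw [grahamLee_apply, (hV.hasFDerivAt_fieldN hz).fderiv, hV.fieldN_eq hz,
      hV.connForm_normalField hz]
    simp
  isPure := hV.isPure_grahamLee

/-! ### Uniqueness -/

theorem contDiffAt_projHoriz_apply (hV : IsFoliatedOn φ V) (hz : z ∈ V) (a : E) :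
    ContDiffAt ℝ ∞ (fun y => projHoriz φ y a) z :=
  (contDiffAt_projHoriz (hV.smooth z hz) (hV.strict z hz)).clm_apply contDiffAt_const

theorem isSectionT10_projSection (hV : IsFoliatedOn φ V) (a : E) :
    IsSectionT10 φ V (projSection φ a) := by
  refine ⟨fun z hz => (hV.contDiffAt_projHoriz_apply hz a).contDiffWithinAt, fun z hz => ?_,
    fun z hz => typeTen_mem_T10.2 (projHoriz_mem (hV.smooth z hz) (hV.strict z hz) a)⟩
  exact ((contDiffAt_const (c := (J : E →L[ℝ] E))).clm_apply
    (hV.contDiffAt_projHoriz_apply hz a)).neg.contDiffWithinAt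

end IsFoliatedOn

/-- Any linear connection differs from the Graham–Lee connection by a tensor. -/
theorem IsLinearConnectionOn.exists_eq_add {nabla : ConnectionOperator E}
    (h : IsLinearConnectionOn nabla V) (hz : z ∈ V) : ∃ D : E →L[ℝ] E →L[ℝ] E,
      ∀ X : E → E, DifferentiableAt ℝ X z → nabla X z = grahamLee φ X z + D (X z) := by
  refine ⟨h.isCovariantDerivativeOn.difference (isCovariantDerivativeOn_grahamLee φ V) z,
    fun X hX => ?_⟩
  have h1 := IsCovariantDerivativeOn.difference_apply h.isCovariantDerivativeOn
    (isCovariantDerivativeOn_grahamLee φ V) hz (mdifferentiableAt_section_iff.2 hX)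
  exact (eq_add_of_sub_eq' h1.symm)

/-- The uniqueness part: the difference tensor `D` of two connections subject to the axioms vanishes.
On `H(𝓕)` it is skew for `G` in its endomorphism part and symmetric in its two arguments, hence zero;
in the directions `T` and `N` it is governed by the type conditions on `τ`. -/
theorem IsFoliatedOn.difference_eq_zero (hV : IsFoliatedOn φ V) (hz : z ∈ V)
    {nabla : ConnectionOperator E} (h : IsGrahamLeeConnection φ V nabla)
    {D : E →L[ℝ] E →L[ℝ] E}
    (hD : ∀ X : E → E, DifferentiableAt ℝ X z → nabla X z = grahamLee φ X z + D (X z)) :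
    D = 0 := by
  have hφ := hV.smooth z hz
  have hs := hV.strict z hz
  have h₀ := hV.isGrahamLeeConnection_grahamLee
  have dN := (hV.hasFDerivAt_fieldN hz).differentiableAt
  have dT := (hV.hasFDerivAt_fieldT hz).differentiableAt
  have dP (a : E) : DifferentiableAt ℝ (fun y => projHoriz φ y a) z :=
    (hV.contDiffAt_projHoriz_apply hz a).differentiableAt_infty
  have dJ (a : E) : DifferentiableAt ℝ (fun y => -J (projHoriz φ y a)) z :=
    (J.differentiableAt.comp z (dP a)).neg
  have dJ' (a : E) : DifferentiableAt ℝ (fun y => -(-J (projHoriz φ y a))) z := (dJ a).neg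
  have d0 : DifferentiableAt ℝ (fun _ : E => (0 : E)) z := differentiableAt_const _
  -- `T` and `N` are parallel for both connections
  have hN : D (normalField φ z) = 0 := by
    have h1 := hD _ dN
    rw [h.parallel_N z hz, h₀.parallel_N z hz, zero_add, hV.fieldN_eq hz] at h1
    exact h1.symm
  have hT : D (J (normalField φ z)) = 0 := by
    have h1 := hD _ dT
    rw [h.parallel_T z hz, h₀.parallel_T z hz, zero_add, hV.fieldT_eq hz] at h1
    exact h1.symm
  have hsec := hV.isSectionT10_projSection
  -- `T_{1,0}(𝓕)` is parallel for both connections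
  have hpar {a : E} (ha : a ∈ horizontal φ z) (v : E) :
      D a v ∈ horizontal φ z ∧ D (J a) v = J (D a v) := by
    obtain ⟨h1, h2⟩ := mem_T10_iff.1 (h.parallel_T10 _ (hsec a) z hz v)
    obtain ⟨h3, h4⟩ := mem_T10_iff.1 (h₀.parallel_T10 _ (hsec a) z hz v)
    have h5 : nabla (fun y => -J (projHoriz φ y a)) z v =
      -J (nabla (fun y => projHoriz φ y a) z v) := congrArg CTangent.im h1
    have h6 : grahamLee φ (fun y => -J (projHoriz φ y a)) z v =
      -J (grahamLee φ (fun y => projHoriz φ y a) z v) := congrArg CTangent.im h3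
    change nabla (fun y => projHoriz φ y a) z v ∈ _ at h2
    change grahamLee φ (fun y => projHoriz φ y a) z v ∈ _ at h4
    rw [hD _ (dJ a), hD _ (dP a)] at h5
    rw [hD _ (dP a)] at h2
    simp only [projHoriz_of_mem ha, add_apply, h6, map_add, map_neg, neg_apply, neg_add,
      add_right_inj, neg_inj] at h5 h2
    exact ⟨(Submodule.add_mem_iff_right _ h4).1 h2, h5⟩
  -- the Levi form is parallel for both connections
  have hskew {a b : E} (ha : a ∈ horizontal φ z) (hb : b ∈ horizontal φ z) (v : E) :
      leviMetric φ z (D a v) b + leviMetric φ z a (D b v) = 0 := by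
    have h1 := h.parallel_levi _ _ (hsec a) (hsec b) z hz v
    rw [h₀.parallel_levi _ _ (hsec a) (hsec b) z hz v] at h1
    have h2 : covC nabla (projSection φ a) z v =
        typeTen (grahamLee φ (fun y => projHoriz φ y a) z v + D a v) := by
      have h3 := congrArg CTangent.im (hV.covC_grahamLee (hsec a) hz v)
      change grahamLee φ (fun y => -J (projHoriz φ y a)) z v =
        -J (grahamLee φ (fun y => projHoriz φ y a) z v) at h3
      ext1
      · change nabla (fun y => projHoriz φ y a) z v = _
        rw [hD _ (dP a), projHoriz_of_mem ha]
        rfl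
      · change nabla (fun y => -J (projHoriz φ y a)) z v = -J _
        rw [hD _ (dJ a), projHoriz_of_mem ha, add_apply, h3, map_neg, neg_apply, (hpar ha v).2,
          map_add, neg_add]
    have h4 : covC nabla (fun y => conj (projSection φ b y)) z v =
        conj (typeTen (grahamLee φ (fun y => projHoriz φ y b) z v + D b v)) := by
      have h3 := congrArg CTangent.im (hV.covC_conj_grahamLee (hsec b) hz v)
      change grahamLee φ (fun y => -(-J (projHoriz φ y b))) z v =
        -(-J (grahamLee φ (fun y => projHoriz φ y b) z v)) at h3
      ext1
      · change nabla (fun y => projHoriz φ y b) z v = _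
        rw [hD _ (dP b), projHoriz_of_mem hb]
        rfl
      · change nabla (fun y => -(-J (projHoriz φ y b))) z v = -(-J _)
        rw [hD _ (dJ' b), projHoriz_of_mem hb, add_apply, h3, neg_neg, neg_neg, neg_neg,
          (hpar hb v).2, map_add]
    rw [h2, h4, hV.covC_grahamLee (hsec a) hz, hV.covC_conj_grahamLee (hsec b) hz,
      projSection_of_mem ha, projSection_of_mem hb, levi_typeTen hφ, levi_typeTen hφ,
      levi_typeTen hφ, levi_typeTen hφ] at h1
    have h5 := congrArg Complex.re h1
    simp [projSection, typeTen] at h5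
    linarith
  have htor {X Y : E → E} (hX : DifferentiableAt ℝ X z) (hY : DifferentiableAt ℝ Y z) :
      torsion nabla X Y z = torsion (grahamLee φ) X Y z + (D (Y z) (X z) - D (X z) (Y z)) := by
    rw [torsion, torsion, hD _ hX, hD _ hY, add_apply, add_apply]
    abel
  -- the torsions agree on `H(𝓕)`
  have hsymm {a b : E} (ha : a ∈ horizontal φ z) (hb : b ∈ horizontal φ z) : D b a = D a b := by
    have h1 := congrArg CTangent.re ((h.isPure.torsion_Z_W _ _ (hsec a) (hsec b) z hz).trans
      (h₀.isPure.torsion_Z_W _ _ (hsec a) (hsec b) z hz).symm)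
    have h2 := congrArg CTangent.re ((h.isPure.torsion_Z_Wbar _ _ (hsec a) (hsec b) z hz).trans
      (h₀.isPure.torsion_Z_Wbar _ _ (hsec a) (hsec b) z hz).symm)
    simp only [torsionC, projSection, typeTen, conj] at h1 h2
    rw [htor (dP a) (dP b), htor (dJ a) (dJ b)] at h1
    rw [htor (dP a) (dP b), htor (dJ a) (dJ' b)] at h2
    simp only [projHoriz_of_mem ha, projHoriz_of_mem hb, map_neg, neg_apply, neg_neg] at h1 h2
    have h3 : (2 : ℝ) • (D b a - D a b) = 0 := by
      linear_combination (norm := module) h1 + h2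
    exact sub_eq_zero.1 ((smul_eq_zero.1 h3).resolve_left two_ne_zero)
  have hH {a b : E} (ha : a ∈ horizontal φ z) (hb : b ∈ horizontal φ z) : D a b = 0 := by
    refine eq_of_leviMetric_eq hφ hs (hpar ha b).1 (zero_mem _) fun c hc => ?_
    rw [map_zero, zero_apply]
    exact eq_zero_of_skew_of_symm (S := horizontal φ z)
      (t := fun b a c => leviMetric φ z (D (a : E) (b : E)) c)
      (fun a b c => by rw [hsymm b.2 a.2])
      (fun b a c => by
        have := hskew a.2 c.2 b
        rw [leviMetric_symm hφ (a : E)] at this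
        linarith) ⟨b, hb⟩ ⟨a, ha⟩ ⟨c, hc⟩
  -- `τ` maps `T_{1,0}(𝓕)` to `T_{0,1}(𝓕)`, so that `D(·, T)` is both `J`-linear and
  -- `J`-antilinear
  have hHT {a : E} (ha : a ∈ horizontal φ z) : D a (J (normalField φ z)) = 0 := by
    have h1 := congrArg CTangent.im
      (mem_T10_iff.1 (h.isPure.tau_T10 _ (hsec a) z hz : conj _ ∈ T10 φ z)).1
    have h2 := congrArg CTangent.im
      (mem_T10_iff.1 (h₀.isPure.tau_T10 _ (hsec a) z hz : conj _ ∈ T10 φ z)).1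
    simp only [tau, torsionC, projSection, typeTen, conj, ofReal] at h1 h2
    rw [htor dT (dJ a), htor d0 (dP a), htor dT (dP a), htor d0 (dJ a)] at h1
    simp only [hV.fieldT_eq hz, projHoriz_of_mem ha, hT, map_zero, map_neg, neg_apply, zero_apply,
      sub_zero, add_zero, (hpar ha _).2, map_add, map_sub, neg_zero] at h1 h2
    have h3 : (2 : ℝ) • J (D a (J (normalField φ z))) = 0 := by
      linear_combination (norm := module) h1 - h2
    have h4 := (smul_eq_zero.1 h3).resolve_left two_ne_zero
    rw [← neg_eq_zero, ← J_J, h4, map_zero]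
  -- `T_∇(N, W)` is determined by `r` and `τ`, so that `D(a, N) = J D(a, T)`
  have hHN {a : E} (ha : a ∈ horizontal φ z) : D a (normalField φ z) = 0 := by
    have h1 := congrArg CTangent.re (h.isPure.torsion_N_W _ (hsec a) z hz)
    have h2 := congrArg CTangent.re (h₀.isPure.torsion_N_W _ (hsec a) z hz)
    simp only [tau, torsionC, projSection, typeTen, ofReal, CTangent.add_re, CTangent.smul_re]
      at h1 h2
    rw [htor dN (dP a), htor d0 (dJ a), htor dT (dP a), htor dT (dJ a), htor d0 (dP a)] at h1
    simp only [hV.fieldT_eq hz, hV.fieldN_eq hz, projHoriz_of_mem ha, hT, hN, hHT ha, map_zero,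
      map_neg, neg_apply, zero_apply, sub_zero, add_zero, (hpar ha _).2, neg_zero] at h1 h2
    linear_combination (norm := module) h1 - h2
  ext w v
  rw [eq_projHoriz_add φ z w, eq_projHoriz_add φ z v]
  have hw := projHoriz_mem hφ hs w
  have hv := projHoriz_mem hφ hs v
  simp [hN, hT, hH hw hv, hHT hw, hHN hw]

end

end GrahamLee

end

theorem theorem4 (n : ℕ) (Ω U : Set (EuclideanSpace ℂ (Fin n)))
    (φ : EuclideanSpace ℂ (Fin n) → ℝ)
    (hΩ : GrahamLee.IsStrictlyPseudoconvexDomain Ω U φ) :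
    (∃ V : Set (EuclideanSpace ℂ (Fin n)), GrahamLee.IsFoliatedOneSidedNhd Ω φ V) ∧
    ∀ V : Set (EuclideanSpace ℂ (Fin n)), GrahamLee.IsFoliatedOneSidedNhd Ω φ V →
      ∃ nabla : GrahamLee.ConnectionOperator (EuclideanSpace ℂ (Fin n)),
        GrahamLee.IsGrahamLeeConnection φ V nabla ∧
        ∀ nabla' : GrahamLee.ConnectionOperator (EuclideanSpace ℂ (Fin n)),
          GrahamLee.IsGrahamLeeConnection φ V nabla' →
            GrahamLee.AgreeOn nabla' nabla V := by
  refine ⟨hΩ.exists_isFoliatedOneSidedNhd, fun V hV => ?_⟩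
  have hV' := hV.isFoliatedOn hΩ
  refine ⟨_, hV'.isGrahamLeeConnection_grahamLee, fun nabla' h' z hz X hX => ?_⟩
  obtain ⟨D, hD⟩ := h'.isLinearConnectionOn.exists_eq_add (φ := φ) hz
  rw [hD X hX, hV'.difference_eq_zero hz h' hD]
  exact add_zero _
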